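/- Let $A$ be a unital C$^*$-algebra, and let $Gl_2(A)^+$ be the set of positive invertible elements of the C$^*$-algebra $M_2(A)$. For $a,b\in Gl_2(A)^+$ and $X=X^*\in M_2(A)$ put $$d_g(a,b)=\|\log(a^{-1/2}ba^{-1/2})\|,\qquad \|X\|_a=\|a^{-1/2}Xa^{-1/2}\|.$$ A geodesic of $Gl_2(A)^+$ is a $C^2$ curve $\gamma$ in $Gl_2(A)^+$, defined on an interval, with $\frac{D\dot\gamma}{dt}=0$, where $\frac{DY}{dt}=\dot Y-\frac12(\dot\gamma\gamma^{-1}Y+Y\gamma^{-1}\dot\gamma)$ for a field $Y$ along $\gamma$. Let $\mathcal H=\{h\in A:\ \mathrm{Im}(h)\text{ is positive and invertible}\}$, $\mathcal D=\{z\in A:\|z\|<1\}$, $$\rho_H=\begin{pmatrix}0&-i\\ i&0\end{pmatrix},\qquad \rho_D=\begin{pmatrix}1&0\\0&-1\end{pmatrix}.$$ For $\rho\in\{\rho_H,\rho_D\}$ let $\mathcal K_\rho$ be the set of columns $x=(x_1,x_2)^{T}\in A^2$ with $x^*\rho x=1$ and $x_1$ invertible, and for $x\in\mathcal K_\rho$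 put $p_x=xx^*\rho\in M_2(A)$. Define $\Phi_H(h)=2p_x-1$ for any $x\in\mathcal K_{\rho_H}$ with $x_2x_1^{-1}=h$ (for instance $x=\frac1{\sqrt2}(1,h)^{T}\,\mathrm{Im}(h)^{-1/2}$), and $\Phi_D(z)=2p_x-1$ for any $x\in\mathcal K_{\rho_D}$ with $x_2x_1^{-1}=z$ (for instance $x=(1,z)^{T}(1-z^*z)^{-1/2}$). These do not depend on the choice of $x$. Use the maps $h\mapsto\rho_H\Phi_H(h)$ and $z\mapsto\rho_D\Phi_D(z)$ into $Gl_2(A)^+$ to transport the geometry: $$d_H(h_1,h_2)=d_g(\rho_H\Phi_H(h_1),\rho_H\Phi_H(h_2)),\qquad d_D(z_1,z_2)=d_g(\rho_D\Phi_D(z_1),\rho_D\Phi_D(z_2));$$ a curve in $\mathcal H$ (resp. $\mathcal D$) is a geodesic if its image in $Gl_2(A)^+$ is a geodesic, and the Finsler length of a $C^1$ curve $[0,1]\to\mathcal H$ (resp. $\mathcal D$) is $\int_0^1\|\dot\gamma(t)\|_{\gamma(t)}\,dt$, where $\gamma$ is its image in $Gl_2(A)^+$. Then $(\mathcal H,d_H)$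 and $(\mathcal D,d_D)$ are non-positively curved metric length spaces. In detail, for $(M,d)$ either of them: 1. $d$ is a distance on $M$. The number $d(x,y)$ is the infimum of the metric lengths (total variations with respect to $d$) of the $d$-continuous curves joining $x$ and $y$, and it is the minimum of the Finsler lengths of the $C^1$ curves joining $x$ and $y$. Any two points of $M$ are joined by a geodesic defined on $[0,1]$, and geodesics are shortest curves: the metric length of a geodesic between any two of its parameters is the distance between the two points, and the Finsler length of a geodesic $\delta$ on $[0,1]$ is $d(\delta(0),\delta(1))$. 2. If $\delta_1,\delta_2$ are geodesics of $M$ defined on an interval $I$, then $t\mapsto d(\delta_1(t),\delta_2(t))$ is convex on $I$. 3. If moreover $[0,1]\subset I$ and $\delta_1(0)=\delta_2(0)$, then $d(\delta_1(t),\delta_2(t))\le t\,d(\delta_1(1),\delta_2(1))$ for all $t\in[0,1]$. Finally, the map $\Gamma(h)=(1+ih)(1-ih)^{-1}$ is a $C^\infty$ diffeomorphism of $\mathcal H$ onto $\mathcal D$, with inverse $z\mapsto i(1-z)(1+z)^{-1}$, and it is an isometry: $d_D(\Gamma(h_1),\Gamma(h_2))=d_H(h_1,h_2)$ for all $h_1,h_2\in\mathcal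 H$. -/

import Mathlib

open scoped ComplexStarModule Ring Matrix ContDiff

noncomputable section

namespace CStarPoincare

variable {A : Type*} [CStarAlgebra A] [PartialOrder A] [StarOrderedRing A]

/-- The C⋆-algebra `M₂(A)` of matrices with entries in `A`. -/
def M2 (A : Type*) := CStarMatrix (Fin 2) (Fin 2) A

instance : CStarAlgebra (M2 A) := inferInstanceAs (CStarAlgebra (CStarMatrix (Fin 2) (Fin 2) A))

instance : PartialOrder (M2 A) := CStarAlgebra.spectralOrder (M2 A)

instance : StarOrderedRing (M2 A) := CStarAlgebra.spectralOrderedRing (M2 A)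

/-- A matrix, as an element of the C⋆-algebra `M₂(A)`. -/
def ofM {A : Type*} (M : Matrix (Fin 2) (Fin 2) A) : M2 A := CStarMatrix.ofMatrix M

/-- The matrix of an element of `M₂(A)`. -/
def toM {A : Type*} (a : M2 A) : Matrix (Fin 2) (Fin 2) A := CStarMatrix.ofMatrix.symm a

lemma toM_mul (a b : M2 A) : toM (a * b) = toM a * toM b := rfl

lemma toM_add (a b : M2 A) : toM (a + b) = toM a + toM b := rfl

lemma toM_star (a : M2 A) : toM (star a) = (toM a).conjTranspose := rfl

lemma toM_one : toM (1 : M2 A) = 1 := rfl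

lemma toM_smul (c : ℂ) (a : M2 A) : toM (c • a) = c • toM a := rfl

/-! ### The half-space, the disk, the forms and their spheres -/

/-- The Poincaré half-space: the elements whose imaginary part is positive and invertible. -/
def halfSpace (A : Type*) [CStarAlgebra A] [PartialOrder A] [StarOrderedRing A] : Set A :=
  {h | IsStrictlyPositive (ℑ h : A)}

/-- The open unit disk of `A`. -/
def openDisk (A : Type*) [CStarAlgebra A] [PartialOrder A] [StarOrderedRing A] : Set A :=
  {z | ‖z‖ < 1}

/-- The reflection with rows `(0, -i)` and `(i, 0)`. -/
def rhoH (A : Type*) [CStarAlgebra A] [PartialOrder A] [StarOrderedRing A] : M2 A :=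
  ofM !![0, -(Complex.I • (1 : A)); Complex.I • (1 : A), 0]

/-- The reflection with rows `(1, 0)` and `(0, -1)`. -/
def rhoD (A : Type*) [CStarAlgebra A] [PartialOrder A] [StarOrderedRing A] : M2 A :=
  ofM !![1, 0; 0, -1]

/-- The `A`-valued inner product `x₁⋆ y₁ + x₂⋆ y₂` of `A²`. -/
def innerA (x y : Fin 2 → A) : A := star (x 0) * y 0 + star (x 1) * y 1

/-- The `A`-valued form `⟨ρ x, y⟩` of `A²`. -/
def form (ρ : M2 A) (x y : Fin 2 → A) : A := innerA (toM ρ *ᵥ x) y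

/-- The unit sphere of the form of `ρ`, with invertible first coordinate. -/
def sphere (ρ : M2 A) : Set (Fin 2 → A) := {x | form ρ x x = 1 ∧ IsUnit (x 0)}

/-- The fibration `(x₁, x₂) ↦ x₂ x₁⁻¹`. -/
def ratio (x : Fin 2 → A) : A := x 1 * (x 0)⁻¹ʳ

/-- The rank one projection `p_x = x x⋆ ρ`. -/
def projOf (ρ : M2 A) (x : Fin 2 → A) : M2 A :=
  ofM (Matrix.vecMulVec x (star x)) * ρ

/-- The reflection `2 p_x - 1`. -/
def reflOf (ρ : M2 A) (x : Fin 2 → A) : M2 A := 2 * projOf ρ x - 1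

/-- The element `(1, h) (2 Im h)^{-1/2}` of the sphere over a point `h` of the half-space. -/
def sectionH (h : A) : Fin 2 → A :=
  ![((√2)⁻¹ : ℝ) • (ℑ h : A) ^ (-(1 / 2) : ℝ),
    ((√2)⁻¹ : ℝ) • (h * (ℑ h : A) ^ (-(1 / 2) : ℝ))]

/-- The element `(1, z) (1 - z⋆ z)^{-1/2}` of the sphere over a point `z` of the disk. -/
def sectionD (z : A) : Fin 2 → A :=
  ![(1 - star z * z) ^ (-(1 / 2) : ℝ), z * (1 - star z * z) ^ (-(1 / 2) : ℝ)]

/-- `Φ_H(h) = 2 p_x - 1` for `x` in the sphere of `ρ_H` over `h`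
(independent of `x`, see `reflOf_eq_PhiH`). -/
def PhiH (h : A) : M2 A := reflOf (rhoH A) (sectionH h)

/-- `Φ_D(z) = 2 p_x - 1` for `x` in the sphere of `ρ_D` over `z`
(independent of `x`, see `reflOf_eq_PhiD`). -/
def PhiD (z : A) : M2 A := reflOf (rhoD A) (sectionD z)

/-! ### The Finsler geometry of the positive invertible matrices -/

/-- The distance `‖log (a^{-1/2} b a^{-1/2})‖` of the set of positive invertible matrices. -/
def dg (a b : M2 A) : ℝ :=
  ‖CFC.log (a ^ (-(1 / 2) : ℝ) * b * a ^ (-(1 / 2) : ℝ))‖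

/-- The Finsler norm `‖a^{-1/2} X a^{-1/2}‖` of a tangent vector `X` at `a`. -/
def finslerNorm (a X : M2 A) : ℝ :=
  ‖a ^ (-(1 / 2) : ℝ) * X * a ^ (-(1 / 2) : ℝ)‖

/-- The Finsler length of a curve parametrized by `[0, 1]`. -/
def finslerLength (γ : ℝ → M2 A) : ℝ :=
  ∫ t in (0 : ℝ)..1, finslerNorm (γ t) (derivWithin γ (Set.Icc 0 1) t)

/-- The covariant derivative `Y' - (γ' γ⁻¹ Y + Y γ⁻¹ γ') / 2` of a field `Y` along a curve `γ`
defined on the interval `I`. -/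
def covDeriv (I : Set ℝ) (γ Y : ℝ → M2 A) (t : ℝ) : M2 A :=
  derivWithin Y I t - (1 / 2 : ℝ) •
    (derivWithin γ I t * (γ t)⁻¹ʳ * Y t + Y t * (γ t)⁻¹ʳ * derivWithin γ I t)

/-- `γ` is, on the interval `I`, a geodesic of the connection of the space of positive invertible
matrices. -/
structure IsGeodesicOn (I : Set ℝ) (γ : ℝ → M2 A) : Prop where
  contDiffOn : ContDiffOn ℝ 2 γ I
  pos : ∀ t ∈ I, IsStrictlyPositive (γ t)
  covDeriv_eq_zero : ∀ t ∈ I, covDeriv I γ (derivWithin γ I) t = 0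

/-! ### The geometry transported to the half-space and to the disk -/

/-- The embedding `h ↦ ρ_H Φ_H(h)` of the half-space in the positive invertible matrices. -/
def embH (h : halfSpace A) : M2 A := rhoH A * PhiH (h : A)

/-- The embedding `z ↦ ρ_D Φ_D(z)` of the disk in the positive invertible matrices. -/
def embD (z : openDisk A) : M2 A := rhoD A * PhiD (z : A)

/-- The distance of the half-space. -/
def dH (h₁ h₂ : halfSpace A) : ℝ := dg (embH h₁) (embH h₂)

/-- The distance of the disk. -/
def dD (z₁ z₂ : openDisk A) : ℝ := dg (embD z₁) (embD z₂)

/-- Geodesics of the half-space, for the transported connection. -/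
def IsGeodesicH (I : Set ℝ) (δ : ℝ → halfSpace A) : Prop := IsGeodesicOn I fun t => embH (δ t)

/-- Geodesics of the disk, for the transported connection. -/
def IsGeodesicD (I : Set ℝ) (δ : ℝ → openDisk A) : Prop := IsGeodesicOn I fun t => embD (δ t)

/-- The transported Finsler length of a curve `[0, 1] → halfSpace A`. -/
def lengthH (c : ℝ → halfSpace A) : ℝ := finslerLength fun t => embH (c t)

/-- The transported Finsler length of a curve `[0, 1] → openDisk A`. -/
def lengthD (c : ℝ → openDisk A) : ℝ := finslerLength fun t => embD (c t)

/-- Continuously differentiable curves `[0, 1] → S` in a subset `S` of `A`. -/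
def IsC1Curve {S : Set A} (c : ℝ → S) : Prop :=
  ContDiffOn ℝ 1 (fun t => (c t : A)) (Set.Icc 0 1)

/-- `d` is a distance on `X`, it is the length distance both for its own metric length and for
the length `len` of the curves of a given class, the given family of geodesics joins all points
by shortest curves, and the curvature is non-positive in the sense of convexity of the distance
between two geodesics. -/
structure IsNonposCurvedLengthSpace {X : Type*} (d : X → X → ℝ)
    (IsGeod : Set ℝ → (ℝ → X) → Prop) (IsCurve : (ℝ → X) → Prop) (len : (ℝ → X) → ℝ) :
    Prop where
  /-- `d` is a distance, equal to the infimum of the lengths (total variations) of the continuous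
  curves joining two points, and geodesics are shortest curves for this length. -/
  metric : ∃ _ : MetricSpace X, (∀ x y, dist x y = d x y) ∧
    (∀ x y : X, edist x y = ⨅ c ∈ {c : ℝ → X | ContinuousOn c (Set.Icc 0 1) ∧
      c 0 = x ∧ c 1 = y}, eVariationOn c (Set.Icc 0 1)) ∧
    (∀ (I : Set ℝ) (δ : ℝ → X), I.OrdConnected → IsGeod I δ → ∀ s ∈ I, ∀ t ∈ I, s ≤ t →
      eVariationOn δ (Set.Icc s t) = edist (δ s) (δ t))
  /-- `d` is the minimum of the lengths `len` of the curves joining two points. -/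
  isLeast_len : ∀ x y : X, IsLeast {l | ∃ c, IsCurve c ∧ c 0 = x ∧ c 1 = y ∧ len c = l} (d x y)
  /-- Geodesics are shortest curves for `len`. -/
  len_geod : ∀ δ, IsGeod (Set.Icc 0 1) δ → len δ = d (δ 0) (δ 1)
  /-- Any two points are joined by a geodesic. -/
  exists_geod : ∀ x y : X, ∃ δ, IsGeod (Set.Icc 0 1) δ ∧ δ 0 = x ∧ δ 1 = y
  /-- The distance between two geodesics is convex. -/
  convexOn : ∀ (I : Set ℝ) (δ₁ δ₂ : ℝ → X), I.OrdConnected → IsGeod I δ₁ → IsGeod I δ₂ →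
    ConvexOn ℝ I fun t => d (δ₁ t) (δ₂ t)
  /-- The comparison for geodesics with the same origin. -/
  chord_le : ∀ (I : Set ℝ) (δ₁ δ₂ : ℝ → X), I.OrdConnected → Set.Icc 0 1 ⊆ I →
    IsGeod I δ₁ → IsGeod I δ₂ → δ₁ 0 = δ₂ 0 →
    ∀ t ∈ Set.Icc (0 : ℝ) 1, d (δ₁ t) (δ₂ t) ≤ t * d (δ₁ 1) (δ₂ 1)

/-- `h ↦ (1 + i h) (1 - i h)⁻¹`. -/
def cayley (h : A) : A := (1 + Complex.I • h) * (1 - Complex.I • h)⁻¹ʳ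

/-- `z ↦ i (1 - z) (1 + z)⁻¹`. -/
def cayleyInv (z : A) : A := Complex.I • ((1 - z) * (1 + z)⁻¹ʳ)

/-! ### The maps `Φ_H` and `Φ_D` do not depend on the chosen points of the spheres -/

lemma reflOf_eq_of_ratio_eq {ρ : M2 A} {x y : Fin 2 → A} (hx : x ∈ sphere ρ) (hy : y ∈ sphere ρ)
    (h : ratio x = ratio y) : reflOf ρ x = reflOf ρ y := by
  obtain ⟨hx1, hx0⟩ := hx
  obtain ⟨hy1, hy0⟩ := hy
  set g : A := (x 0)⁻¹ʳ * y 0 with hg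
  have hyx : y = fun i => x i * g := by
    funext i
    fin_cases i
    · simp [hg, ← mul_assoc, Ring.mul_inverse_cancel _ hx0]
    · have : y 1 = ratio y * y 0 := by
        simp [ratio, mul_assoc, Ring.inverse_mul_cancel _ hy0]
      rw [← h] at this
      simpa [ratio, hg, mul_assoc] using this
  have hform : form ρ y y = star g * form ρ x x * g := by
    rw [hyx]
    simp only [form, innerA, Matrix.mulVec, dotProduct, Fin.sum_univ_two, star_add, star_mul,
      mul_add, add_mul, mul_assoc]
  have hgg : star g * g = 1 := by
    rw [hx1, hy1, mul_one] at hform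
    exact hform.symm
  have hgu : IsUnit g := hx0.ringInverse.mul hy0
  have hgg' : g * star g = 1 := by
    obtain ⟨u, hu⟩ := hgu
    rw [← hu] at hgg ⊢
    rw [eq_comm, ← Units.inv_eq_of_mul_eq_one_left hgg, Units.mul_inv]
  have : Matrix.vecMulVec y (star y) = Matrix.vecMulVec x (star x) := by
    ext i j
    simp only [Matrix.vecMulVec_apply, Pi.star_apply, hyx, star_mul]
    rw [mul_assoc, ← mul_assoc g, hgg', one_mul]
  simp [reflOf, projOf, this]

lemma rpow_neg_half_conj {a : A} (ha : IsStrictlyPositive a) :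
    a ^ (-(1 / 2) : ℝ) * a * a ^ (-(1 / 2) : ℝ) = 1 := by
  have h : a = a ^ (1 / 2 : ℝ) * a ^ (1 / 2 : ℝ) := by
    rw [← CFC.rpow_add ha.isUnit]
    norm_num
    exact (CFC.rpow_one a ha.nonneg).symm
  nth_rw 2 [h]
  rw [← mul_assoc, CFC.rpow_neg_mul_rpow (1 / 2) ha, one_mul, CFC.rpow_mul_rpow_neg (1 / 2) ha]

lemma sectionH_mem {h : A} (hh : h ∈ halfSpace A) :
    sectionH h ∈ sphere (rhoH A) ∧ ratio (sectionH h) = h := by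
  have hh' : IsStrictlyPositive (ℑ h : A) := hh
  set s : A := (ℑ h : A) ^ (-(1 / 2) : ℝ) with hs
  have hsu : IsUnit s := hh'.isUnit.cfcRpow _ hh'.nonneg
  have hsa : star s = s := (CFC.rpow_nonneg (a := (ℑ h : A))).isSelfAdjoint
  have h2 : ((√2)⁻¹ : ℝ) * (√2)⁻¹ = 2⁻¹ := by
    rw [← mul_inv, Real.mul_self_sqrt (by norm_num)]
  have h0 : (√2 : ℝ)⁻¹ ≠ 0 := by positivity
  have h0u : IsUnit (((√2)⁻¹ : ℝ) • s) := by
    have := hsu.smul (Units.mk0 _ h0)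
    simpa [Units.smul_def] using this
  refine ⟨⟨?_, h0u⟩, ?_⟩
  · have key := rpow_neg_half_conj hh'
    rw [← hs, imaginaryPart_apply_coe] at key
    rw [← key]
    simp only [form, innerA, rhoH, ofM, toM, sectionH, ← hs, Matrix.mulVec, dotProduct, Fin.sum_univ_two]
    simp [hsa]
    rw [smul_smul, smul_smul, h2, smul_comm (2⁻¹ : ℝ), smul_comm (2⁻¹ : ℝ), mul_sub, sub_mul,
      smul_sub, smul_sub]
    simp only [mul_assoc]
    abel
  · have h0u' : IsUnit (sectionH h 0) := h0u
    have : sectionH h 1 = h * sectionH h 0 := by simp [sectionH]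
    rw [ratio, this, mul_assoc, Ring.mul_inverse_cancel _ h0u', mul_one]

lemma sectionD_mem {z : A} (hz : z ∈ openDisk A) :
    sectionD z ∈ sphere (rhoD A) ∧ ratio (sectionD z) = z := by
  have hp : IsStrictlyPositive (1 - star z * z) := by
    have hn : ‖star z * z‖ < 1 := by
      rw [CStarRing.norm_star_mul_self]
      have : ‖z‖ < 1 := hz
      nlinarith [norm_nonneg z]
    refine IsStrictlyPositive.iff_of_unital.2 ⟨?_, isUnit_one_sub_of_norm_lt_one hn⟩
    exact sub_nonneg.2 ((CStarAlgebra.norm_le_one_iff_of_nonneg _ (star_mul_self_nonneg z)).1 hn.le)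
  set s : A := (1 - star z * z) ^ (-(1 / 2) : ℝ) with hs
  have hsu : IsUnit s := hp.isUnit.cfcRpow _ hp.nonneg
  have hsa : star s = s := (CFC.rpow_nonneg (a := 1 - star z * z)).isSelfAdjoint
  refine ⟨⟨?_, hsu⟩, ?_⟩
  · have key := rpow_neg_half_conj hp
    rw [← hs] at key
    rw [← key]
    simp only [form, innerA, rhoD, ofM, toM, sectionD, ← hs, Matrix.mulVec, dotProduct, Fin.sum_univ_two]
    simp [hsa]
    noncomm_ring
  · have hsu' : IsUnit (sectionD z 0) := hsu
    have : sectionD z 1 = z * sectionD z 0 := by simp [sectionD]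
    rw [ratio, this, mul_assoc, Ring.mul_inverse_cancel _ hsu', mul_one]

lemma reflOf_eq_PhiH {h : A} (hh : h ∈ halfSpace A) {x : Fin 2 → A} (hx : x ∈ sphere (rhoH A))
    (hxh : ratio x = h) : reflOf (rhoH A) x = PhiH h :=
  reflOf_eq_of_ratio_eq hx (sectionH_mem hh).1 (hxh.trans (sectionH_mem hh).2.symm)

lemma reflOf_eq_PhiD {z : A} (hz : z ∈ openDisk A) {x : Fin 2 → A} (hx : x ∈ sphere (rhoD A))
    (hxz : ratio x = z) : reflOf (rhoD A) x = PhiD z :=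
  reflOf_eq_of_ratio_eq hx (sectionD_mem hz).1 (hxz.trans (sectionD_mem hz).2.symm)

end CStarPoincare

end

open CStarPoincare

/-!
The distance `d_g` of the positive invertible matrices is the Thompson metric: `d_g a b ≤ r` if and
only if `b ≤ exp r • a` and `a ≤ exp r • b` (`dg_le_iff`). The metric axioms and the invariance
under congruences `a ↦ g a g⋆` are immediate from this.

For a geodesic `γ` the element `γ⁻¹ γ'` is constant, so `γ` is
`t ↦ γ(s)^{1/2} exp ((t - s) V) γ(s)^{1/2}` with `V` self-adjoint (`IsGeodesicOn.eq_exp_conj`).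
Hence `γ` has constant speed `‖V‖`, its distances are proportional to the parameter, and between
two of its points `a`, `b` it is the curve of weighted geometric means
`a^{1/2} (a^{-1/2} b a^{-1/2})^t a^{1/2}` (`IsGeodesicOn.eq_geoMean`). Since `x ↦ x ^ t` is operator
monotone for `t ∈ [0, 1]`, two geodesics with the same origin satisfy
`d_g (γ₁ t) (γ₂ t) ≤ t * d_g (γ₁ 1) (γ₂ 1)` (`dg_geoMean_le`). Comparing two arbitrary geodesics
with the one which joins the origin of the first to the end of the second gives convexity
(`convexOn_dg`). Geodesics are also shortest for the Finsler length: with `F` the arc length of `γ`,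
`-F' γ ≤ γ' ≤ F' γ`, so that `exp F • γ` increases and `exp (-F) • γ` decreases
(`dg_le_finslerLength`).

For a symmetry `ρ`, the positive `a` with `a ρ a = ρ` are totally geodesic
(`geoMean_mul_mul_geoMean`): the symmetry `a^{1/2} ρ a^{1/2}` maps the initial velocity `V` to `-V`.
An embedding onto such a set therefore transports the whole geometry
(`isNonposCurvedLengthSpace_of_embedding`). The image of the disk is exactly this set for `ρ_D`
(`embD_mul_rhoD_mul_embD`, `exists_embD_eq`), with a coordinate `z` which is a rational function of
the entries. A unitary matrix carries the form of `ρ_H` to the form of `ρ_D` and induces the Cayley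
transform on the ratios `x₂ x₁⁻¹`, so the embeddings of the half-space and of the disk differ by the
Cayley transform and a unitary conjugation (`embD_cayleyEquiv`).
-/

noncomputable section

namespace CStarPoincare

/-! ### Functional calculus and order in a C⋆-algebra -/

section CStar

variable {B : Type*} [CStarAlgebra B]

lemma ringInverse_eq_of_mul_eq_one {x y : B} (hxy : x * y = 1) (hyx : y * x = 1) : x⁻¹ʳ = y :=
  Ring.inverse_unit (⟨x, y, hxy, hyx⟩ : Bˣ)

lemma exp_mul_exp_neg (v : B) : NormedSpace.exp v * NormedSpace.exp (-v) = 1 := by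
  let _ : NormedAlgebra ℚ B := NormedAlgebra.restrictScalars ℚ ℝ B
  rw [← NormedSpace.exp_add_of_commute (Commute.refl v).neg_right, add_neg_cancel,
    NormedSpace.exp_zero]

lemma exp_conj_of_mul_eq_one {p q : B} (hpq : p * q = 1) (hqp : q * p = 1) (v : B) :
    NormedSpace.exp (p * v * q) = p * NormedSpace.exp v * q := by
  let _ : NormedAlgebra ℚ B := NormedAlgebra.restrictScalars ℚ ℝ B
  exact NormedSpace.exp_units_conj (⟨p, q, hpq, hqp⟩ : Bˣ) v

/-- The real exponential is injective on self-adjoint elements. -/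
lemma eq_of_exp_eq {v w : B} (hv : IsSelfAdjoint v) (hw : IsSelfAdjoint w)
    (h : NormedSpace.exp v = NormedSpace.exp w) : v = w := by
  rw [← CFC.log_exp v hv, h, CFC.log_exp w hw]

lemma contDiff_exp_smul (v : B) (n : WithTop ℕ∞) :
    ContDiff ℝ n fun t : ℝ => NormedSpace.exp (t • v) := by
  have : ContDiff ℝ n (NormedSpace.exp : B → B) :=
    contDiff_iff_contDiffAt.2 fun x => (NormedSpace.exp_analytic (𝕂 := ℝ) x).contDiffAt
  exact this.comp (contDiff_id.smul contDiff_const)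

lemma contDiffAt_ringInverse_of_isUnit {x : B} (hx : IsUnit x) (n : WithTop ℕ∞) :
    ContDiffAt ℝ n Ring.inverse x := by
  obtain ⟨u, rfl⟩ := hx
  exact contDiffAt_ringInverse ℝ u

variable [PartialOrder B] [StarOrderedRing B]

lemma star_rpow_eq (a : B) (y : ℝ) : star (a ^ y) = a ^ y :=
  (CFC.rpow_nonneg (a := a)).isSelfAdjoint

lemma rpow_half_mul_rpow_half {a : B} (ha : IsStrictlyPositive a) :
    a ^ (1 / 2 : ℝ) * a ^ (1 / 2 : ℝ) = a := by
  rw [← CFC.rpow_add ha.isUnit]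
  norm_num
  exact CFC.rpow_one a ha.nonneg

lemma rpow_half_mul_rpow_neg_half {a : B} (ha : IsStrictlyPositive a) :
    a ^ (1 / 2 : ℝ) * a ^ (-(1 / 2) : ℝ) = 1 :=
  CFC.rpow_mul_rpow_neg (1 / 2) ha

lemma rpow_neg_half_mul_rpow_half {a : B} (ha : IsStrictlyPositive a) :
    a ^ (-(1 / 2) : ℝ) * a ^ (1 / 2 : ℝ) = 1 :=
  CFC.rpow_neg_mul_rpow (1 / 2) ha

lemma rpow_half_conj_rpow_neg_half_conj {a : B} (ha : IsStrictlyPositive a) (x : B) :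
    a ^ (1 / 2 : ℝ) * (a ^ (-(1 / 2) : ℝ) * x * a ^ (-(1 / 2) : ℝ)) * a ^ (1 / 2 : ℝ) = x := by
  have h₁ := rpow_half_mul_rpow_neg_half ha
  have h₂ := rpow_neg_half_mul_rpow_half ha
  calc _ = (a ^ (1 / 2 : ℝ) * a ^ (-(1 / 2) : ℝ)) * x *
        (a ^ (-(1 / 2) : ℝ) * a ^ (1 / 2 : ℝ)) := by simp only [mul_assoc]
    _ = x := by rw [h₁, h₂, one_mul, mul_one]

lemma rpow_neg_half_conj_rpow_half_conj {a : B} (ha : IsStrictlyPositive a) (x : B) :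
    a ^ (-(1 / 2) : ℝ) * (a ^ (1 / 2 : ℝ) * x * a ^ (1 / 2 : ℝ)) * a ^ (-(1 / 2) : ℝ) = x := by
  have h₁ := rpow_half_mul_rpow_neg_half ha
  have h₂ := rpow_neg_half_mul_rpow_half ha
  calc _ = (a ^ (-(1 / 2) : ℝ) * a ^ (1 / 2 : ℝ)) * x *
        (a ^ (1 / 2 : ℝ) * a ^ (-(1 / 2) : ℝ)) := by simp only [mul_assoc]
    _ = x := by rw [h₁, h₂, one_mul, mul_one]

lemma rpow_neg_half_mul_self {a : B} (ha : IsStrictlyPositive a) :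
    a ^ (-(1 / 2) : ℝ) * a ^ (-(1 / 2) : ℝ) = a⁻¹ʳ := by
  rw [CFC.inverse_eq_rpow_neg_one ha, ← CFC.rpow_add ha.isUnit]
  norm_num

lemma rpow_conj_le {x y : B} (h : x ≤ y) (a : B) (s : ℝ) : a ^ s * x * a ^ s ≤ a ^ s * y * a ^ s :=
  (CFC.rpow_nonneg (a := a)).isSelfAdjoint.conjugate_le_conjugate h

lemma isStrictlyPositive_rpow_conj {a b : B} (ha : IsStrictlyPositive a)
    (hb : IsStrictlyPositive b) (s : ℝ) : IsStrictlyPositive (a ^ s * b * a ^ s) :=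
  IsStrictlyPositive.conjugate_of_isUnit_of_isSelfAdjoint b _ (ha.isUnit.cfcRpow s ha.nonneg)
    (CFC.rpow_nonneg (a := a)).isSelfAdjoint hb

lemma isStrictlyPositive_exp {v : B} (hv : IsSelfAdjoint v) :
    IsStrictlyPositive (NormedSpace.exp v) := by
  let _ : NormedAlgebra ℚ B := NormedAlgebra.restrictScalars ℚ ℝ B
  exact (NormedSpace.isUnit_exp v).isStrictlyPositive hv.exp_nonneg

lemma exp_smul_log {c : B} (hc : IsStrictlyPositive c) (t : ℝ) :
    NormedSpace.exp (t • CFC.log c) = c ^ t := by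
  have hpos : ∀ x ∈ spectrum ℝ c, 0 < x := fun x hx => hc.spectrum_pos hx
  have hl : ContinuousOn Real.log (spectrum ℝ c) :=
    Real.continuousOn_log.mono fun x hx => (hpos x hx).ne'
  rw [CFC.rpow_eq_cfc_real hc.nonneg, CFC.log, ← cfc_smul t Real.log c hl,
    ← CFC.real_exp_eq_normedSpace_exp (cfc_predicate _ c),
    ← cfc_comp' Real.exp (fun x => t • Real.log x) c (by fun_prop) (hl.const_smul t)
      hc.isSelfAdjoint]
  refine cfc_congr fun x hx => ?_
  rw [Real.rpow_def_of_pos (hpos x hx), smul_eq_mul, mul_comm]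

lemma smul_rpow_eq {c : B} (hc : IsStrictlyPositive c) {r : ℝ} (hr : 0 < r) (t : ℝ) :
    (r • c) ^ t = r ^ t • c ^ t := by
  have hpos : ∀ x ∈ spectrum ℝ c, 0 < x := fun x hx => hc.spectrum_pos hx
  have hcont : ContinuousOn (fun x : ℝ => x ^ t) (spectrum ℝ c) := fun x hx =>
    (Real.continuousAt_rpow_const x t (Or.inl (hpos x hx).ne')).continuousWithinAt
  have hcont' : ContinuousOn (fun x : ℝ => x ^ t) ((fun x => r • x) '' spectrum ℝ c) := by
    rintro _ ⟨x, hx, rfl⟩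
    exact (Real.continuousAt_rpow_const _ t
      (Or.inl (mul_pos hr (hpos x hx)).ne')).continuousWithinAt
  rw [CFC.rpow_eq_cfc_real (hc.smul hr).nonneg, CFC.rpow_eq_cfc_real hc.nonneg,
    ← cfc_smul_id (R := ℝ) r c hc.isSelfAdjoint,
    ← cfc_comp' (fun x => x ^ t) (fun x => r • x) c hcont' (by fun_prop) hc.isSelfAdjoint,
    ← cfc_smul _ _ _ hcont]
  refine cfc_congr fun x hx => ?_
  simp only [smul_eq_mul]
  rw [Real.mul_rpow hr.le (hpos x hx).le]

/-- The spectral form of the bounds which define the Thompson metric. -/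
lemma norm_log_le_iff {c : B} (hc : IsStrictlyPositive c) {r : ℝ} (hr : 0 ≤ r) :
    ‖CFC.log c‖ ≤ r ↔ c ≤ Real.exp r • 1 ∧ 1 ≤ Real.exp r • c := by
  have hpos : ∀ x ∈ spectrum ℝ c, 0 < x := fun x hx => hc.spectrum_pos hx
  have hl : ContinuousOn Real.log (spectrum ℝ c) :=
    Real.continuousOn_log.mono fun x hx => (hpos x hx).ne'
  have h2 : (1 : B) ≤ Real.exp r • c ↔ algebraMap ℝ B (Real.exp (-r)) ≤ c := by
    rw [Algebra.algebraMap_eq_smul_one]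
    constructor <;> intro h
    · have := smul_le_smul_of_nonneg_left h (Real.exp_pos (-r)).le
      rwa [smul_smul, ← Real.exp_add, neg_add_cancel, Real.exp_zero, one_smul] at this
    · have := smul_le_smul_of_nonneg_left h (Real.exp_pos r).le
      rwa [smul_smul, ← Real.exp_add, add_neg_cancel, Real.exp_zero, one_smul] at this
  rw [h2, ← Algebra.algebraMap_eq_smul_one, le_algebraMap_iff_spectrum_le (p := IsSelfAdjoint)
    hc.isSelfAdjoint, algebraMap_le_iff_le_spectrum (p := IsSelfAdjoint) hc.isSelfAdjoint,
    CFC.log, norm_cfc_le_iff _ _ hr hl hc.isSelfAdjoint, ← forall₂_and]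
  refine forall₂_congr fun x hx => ?_
  rw [Real.norm_eq_abs, abs_le, Real.le_log_iff_exp_le (hpos x hx),
    Real.log_le_iff_le_exp (hpos x hx), and_comm]

lemma le_norm_smul_one {x : B} (hx : IsSelfAdjoint x) : x ≤ ‖x‖ • 1 := by
  rw [← Algebra.algebraMap_eq_smul_one]
  exact hx.le_algebraMap_norm_self

lemma continuousOn_rpow_comp {γ : ℝ → B} {I : Set ℝ} (hγ : ContinuousOn γ I)
    (hpos : ∀ t ∈ I, IsStrictlyPositive (γ t)) (s : ℝ) : ContinuousOn (fun t => γ t ^ s) I :=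
  (CFC.continuousOn_rpow s).comp hγ hpos

/-- An element whose real part is positive and invertible is invertible: it is of the form
`r (1 + i c) r` with `r`, `c` self-adjoint and `r` invertible, and the spectrum of `c` is real. -/
lemma isUnit_add_I_smul {a b : B} (ha : IsStrictlyPositive a) (hb : IsSelfAdjoint b) :
    IsUnit (a + Complex.I • b) := by
  set c := a ^ (-(1 / 2) : ℝ) * b * a ^ (-(1 / 2) : ℝ) with hc
  have hcs : IsSelfAdjoint c := by
    rw [hc, IsSelfAdjoint, star_mul, star_mul, star_rpow_eq, hb.star_eq, mul_assoc]
  have h1 : IsUnit (1 + Complex.I • c) := by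
    have : Complex.I ∉ spectrum ℂ c := fun h => by
      have := hcs.im_eq_zero_of_mem_spectrum h
      simp at this
    rw [spectrum.notMem_iff] at this
    have h2 : 1 + Complex.I • c =
        (Units.mk0 (-Complex.I) (neg_ne_zero.2 Complex.I_ne_zero)) •
          (algebraMap ℂ B Complex.I - c) := by
      rw [Units.smul_def, Algebra.algebraMap_eq_smul_one, smul_sub, smul_smul]
      simp
    rw [h2]
    exact this.smul _
  have h3 : a + Complex.I • b =
      a ^ (1 / 2 : ℝ) * (1 + Complex.I • c) * a ^ (1 / 2 : ℝ) := by
    rw [mul_add, add_mul, mul_one, rpow_half_mul_rpow_half ha, mul_smul_comm, smul_mul_assoc, hc,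
      rpow_half_conj_rpow_neg_half_conj ha]
  rw [h3]
  have hu := ha.isUnit.cfcRpow (1 / 2) ha.nonneg
  exact (hu.mul h1).mul hu

/-- `‖z‖ < 1` when `1 - z⋆ z` is positive and invertible. -/
lemma norm_lt_one_of_isStrictlyPositive {z : B} (h : IsStrictlyPositive (1 - star z * z)) :
    ‖z‖ < 1 := by
  nontriviality B
  obtain ⟨r, hr, hle⟩ := (CFC.exists_pos_algebraMap_le_iff h.isSelfAdjoint).2
    fun x hx => h.spectrum_pos hx
  have h1 : star z * z ≤ algebraMap ℝ B (1 - r) := by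
    rw [map_sub, map_one]
    exact le_sub_comm.1 hle
  have h2 : ‖star z * z‖ ≤ max (1 - r) 0 := by
    rw [CStarAlgebra.norm_le_iff_le_algebraMap _ (le_max_right _ _) (star_mul_self_nonneg z)]
    refine h1.trans ?_
    exact algebraMap_mono B (le_max_left _ _)
  rw [CStarRing.norm_star_mul_self] at h2
  have : max (1 - r) 0 < 1 := max_lt (by linarith) one_pos
  nlinarith [norm_nonneg z]

lemma isStrictlyPositive_one_sub_star_mul {z : B} (hz : ‖z‖ < 1) :
    IsStrictlyPositive (1 - star z * z) := by
  have hn : ‖star z * z‖ < 1 := by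
    rw [CStarRing.norm_star_mul_self]
    nlinarith [norm_nonneg z]
  refine IsStrictlyPositive.iff_of_unital.2 ⟨?_, isUnit_one_sub_of_norm_lt_one hn⟩
  exact sub_nonneg.2 ((CStarAlgebra.norm_le_one_iff_of_nonneg _ (star_mul_self_nonneg z)).1 hn.le)

/-- Integration of a differential inequality in a C⋆-algebra: a curve with positive velocity is
increasing, because the positive cone is closed and convex. -/
lemma le_of_hasDerivAt_nonneg {g g' : ℝ → B} (hg : ContinuousOn g (Set.Icc 0 1))
    (hg' : ContinuousOn g' (Set.Icc 0 1)) (hd : ∀ t ∈ Set.Ioo (0 : ℝ) 1, HasDerivAt g (g' t) t)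
    (hpos : ∀ t ∈ Set.Icc (0 : ℝ) 1, 0 ≤ g' t) : g 0 ≤ g 1 := by
  have h := intervalIntegral.integral_eq_sub_of_hasDerivAt_of_le zero_le_one hg hd
    (ContinuousOn.intervalIntegrable (by rwa [Set.uIcc_of_le zero_le_one]))
  rw [← sub_nonneg, ← h, intervalIntegral.integral_of_le zero_le_one]
  refine MeasureTheory.integral_nonneg_of_ae ?_
  filter_upwards [MeasureTheory.ae_restrict_mem measurableSet_Ioc] with t ht
  exact hpos t ⟨ht.1.le, ht.2⟩

end CStar

section

variable {A : Type*} [CStarAlgebra A] [PartialOrder A] [StarOrderedRing A]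

/-! ### The Thompson metric and geometric means -/

/-- `dg` is the Thompson metric of the positive cone. All its metric properties are read off
from this description by order bounds. -/
lemma dg_le_iff {a b : M2 A} (ha : IsStrictlyPositive a) (hb : IsStrictlyPositive b) {r : ℝ}
    (hr : 0 ≤ r) : dg a b ≤ r ↔ b ≤ Real.exp r • a ∧ a ≤ Real.exp r • b := by
  rw [dg, norm_log_le_iff (isStrictlyPositive_rpow_conj ha hb _) hr]
  have e1 := rpow_half_conj_rpow_neg_half_conj ha b
  have e2 := rpow_neg_half_conj ha
  have e3 := rpow_half_mul_rpow_half ha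
  refine and_congr ⟨fun h => ?_, fun h => ?_⟩ ⟨fun h => ?_, fun h => ?_⟩
  · have := rpow_conj_le h a (1 / 2)
    rwa [e1, mul_smul_comm, smul_mul_assoc, mul_one, e3] at this
  · have := rpow_conj_le h a (-(1 / 2))
    rwa [mul_smul_comm, smul_mul_assoc, e2] at this
  · have := rpow_conj_le h a (1 / 2)
    rwa [mul_smul_comm, smul_mul_assoc, e1, mul_one, e3] at this
  · have := rpow_conj_le h a (-(1 / 2))
    rwa [mul_smul_comm, smul_mul_assoc, e2] at this

lemma dg_nonneg (a b : M2 A) : 0 ≤ dg a b := norm_nonneg _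

lemma dg_comm {a b : M2 A} (ha : IsStrictlyPositive a) (hb : IsStrictlyPositive b) :
    dg a b = dg b a :=
  le_antisymm
    ((dg_le_iff ha hb (dg_nonneg _ _)).2 ((dg_le_iff hb ha (dg_nonneg _ _)).1 le_rfl).symm)
    ((dg_le_iff hb ha (dg_nonneg _ _)).2 ((dg_le_iff ha hb (dg_nonneg _ _)).1 le_rfl).symm)

lemma dg_self {a : M2 A} (ha : IsStrictlyPositive a) : dg a a = 0 :=
  le_antisymm ((dg_le_iff ha ha le_rfl).2 (by simp)) (dg_nonneg _ _)

lemma dg_triangle {a b c : M2 A} (ha : IsStrictlyPositive a) (hb : IsStrictlyPositive b)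
    (hc : IsStrictlyPositive c) : dg a c ≤ dg a b + dg b c := by
  obtain ⟨h1, h2⟩ := (dg_le_iff ha hb (dg_nonneg _ _)).1 le_rfl
  obtain ⟨h3, h4⟩ := (dg_le_iff hb hc (dg_nonneg _ _)).1 le_rfl
  rw [dg_le_iff ha hc (add_nonneg (dg_nonneg _ _) (dg_nonneg _ _))]
  constructor
  · refine h3.trans ?_
    rw [add_comm, Real.exp_add, mul_smul]
    exact smul_le_smul_of_nonneg_left h1 (Real.exp_pos _).le
  · refine h2.trans ?_
    rw [Real.exp_add, mul_smul]
    exact smul_le_smul_of_nonneg_left h4 (Real.exp_pos _).le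

lemma eq_of_dg_eq_zero {a b : M2 A} (ha : IsStrictlyPositive a) (hb : IsStrictlyPositive b)
    (h : dg a b = 0) : a = b := by
  obtain ⟨h1, h2⟩ := (dg_le_iff ha hb le_rfl).1 h.le
  simp only [Real.exp_zero, one_smul] at h1 h2
  exact le_antisymm h2 h1

/-- Congruences act by isometries. -/
lemma dg_conj {a b g k : M2 A} (ha : IsStrictlyPositive a) (hb : IsStrictlyPositive b)
    (hg : IsUnit g) (hk : k = star g) : dg (g * a * k) (g * b * k) = dg a b := by
  subst hk
  have ha' := hg.isStrictlyPositive_star_right_conjugate_iff.2 ha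
  have hb' := hg.isStrictlyPositive_star_right_conjugate_iff.2 hb
  have key : ∀ {x y : M2 A} (r : ℝ), g * x * star g ≤ r • (g * y * star g) ↔ x ≤ r • y := by
    intro x y r
    rw [← sub_nonneg, ← sub_nonneg (b := x), ← hg.star_right_conjugate_nonneg_iff (x := r • y - x),
      mul_sub, sub_mul, mul_smul_comm, smul_mul_assoc]
  refine eq_of_forall_ge_iff fun r => ?_
  by_cases hr : 0 ≤ r
  · rw [dg_le_iff ha' hb' hr, dg_le_iff ha hb hr, key, key]
  · exact iff_of_false (fun h => hr ((dg_nonneg _ _).trans h))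
      (fun h => hr ((dg_nonneg _ _).trans h))

lemma dg_exp {a v : M2 A} (ha : IsStrictlyPositive a) (hv : IsSelfAdjoint v) :
    dg a (a ^ (1 / 2 : ℝ) * NormedSpace.exp v * a ^ (1 / 2 : ℝ)) = ‖v‖ := by
  rw [dg, rpow_neg_half_conj_rpow_half_conj ha, CFC.log_exp v hv]

/-- The curve from `a` to `b` given by the weighted geometric means. -/
def geoMean (a b : M2 A) (t : ℝ) : M2 A :=
  a ^ (1 / 2 : ℝ) * (a ^ (-(1 / 2) : ℝ) * b * a ^ (-(1 / 2) : ℝ)) ^ t * a ^ (1 / 2 : ℝ)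

lemma geoMean_eq_exp {a b : M2 A} (ha : IsStrictlyPositive a) (hb : IsStrictlyPositive b)
    (t : ℝ) : geoMean a b t = a ^ (1 / 2 : ℝ) *
      NormedSpace.exp (t • CFC.log (a ^ (-(1 / 2) : ℝ) * b * a ^ (-(1 / 2) : ℝ))) *
        a ^ (1 / 2 : ℝ) := by
  rw [geoMean, exp_smul_log (isStrictlyPositive_rpow_conj ha hb _)]

lemma geoMean_zero {a b : M2 A} (ha : IsStrictlyPositive a) (hb : IsStrictlyPositive b) :
    geoMean a b 0 = a := by
  rw [geoMean_eq_exp ha hb, zero_smul, NormedSpace.exp_zero, mul_one, rpow_half_mul_rpow_half ha]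

lemma geoMean_one {a b : M2 A} (ha : IsStrictlyPositive a) (hb : IsStrictlyPositive b) :
    geoMean a b 1 = b := by
  rw [geoMean, CFC.rpow_one _ (isStrictlyPositive_rpow_conj ha hb _).nonneg,
    rpow_half_conj_rpow_neg_half_conj ha]

lemma isStrictlyPositive_geoMean {a b : M2 A} (ha : IsStrictlyPositive a)
    (hb : IsStrictlyPositive b) (t : ℝ) : IsStrictlyPositive (geoMean a b t) :=
  isStrictlyPositive_rpow_conj ha ((isStrictlyPositive_rpow_conj ha hb _).rpow _ t) _

/-- The contraction property behind non-positive curvature: it is the operator monotonicity of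
`x ↦ x ^ t` for exponents `t ∈ [0, 1]`. -/
lemma dg_geoMean_le {a b c : M2 A} (ha : IsStrictlyPositive a) (hb : IsStrictlyPositive b)
    (hc : IsStrictlyPositive c) {t : ℝ} (ht : t ∈ Set.Icc (0 : ℝ) 1) :
    dg (geoMean a b t) (geoMean a c t) ≤ t * dg b c := by
  have key : ∀ {x y : M2 A} {r : ℝ}, IsStrictlyPositive y →
      x ≤ Real.exp r • y → geoMean a x t ≤ Real.exp (t * r) • geoMean a y t := by
    intro x y r hy h
    have h1 := rpow_conj_le h a (-(1 / 2))
    rw [mul_smul_comm, smul_mul_assoc] at h1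
    have h2 := rpow_conj_le (CFC.rpow_le_rpow ht h1) a (1 / 2)
    rwa [smul_rpow_eq (isStrictlyPositive_rpow_conj ha hy _) (Real.exp_pos r), mul_smul_comm,
      smul_mul_assoc, ← Real.exp_mul, mul_comm r t] at h2
  obtain ⟨h1, h2⟩ := (dg_le_iff hb hc (dg_nonneg _ _)).1 le_rfl
  rw [dg_le_iff (isStrictlyPositive_geoMean ha hb t) (isStrictlyPositive_geoMean ha hc t)
    (mul_nonneg ht.1 (dg_nonneg _ _))]
  exact ⟨key hb h1, key hc h2⟩

lemma isStrictlyPositive_exp_conj {a v : M2 A} (ha : IsStrictlyPositive a)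
    (hv : IsSelfAdjoint v) (t : ℝ) :
    IsStrictlyPositive (a ^ (1 / 2 : ℝ) * NormedSpace.exp (t • v) * a ^ (1 / 2 : ℝ)) :=
  isStrictlyPositive_rpow_conj ha (isStrictlyPositive_exp ((IsSelfAdjoint.all t).smul hv)) _

lemma hasDerivAt_exp_conj (p v : M2 A) (t : ℝ) :
    HasDerivAt (fun t : ℝ => p * NormedSpace.exp (t • v) * p)
      (p * (NormedSpace.exp (t • v) * v) * p) t :=
  ((hasDerivAt_exp_smul_const v t).const_mul p).mul_const p

lemma isGeodesicOn_exp_conj {a v : M2 A} (ha : IsStrictlyPositive a) (hv : IsSelfAdjoint v)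
    {I : Set ℝ} (hI : UniqueDiffOn ℝ I) :
    IsGeodesicOn I fun t => a ^ (1 / 2 : ℝ) * NormedSpace.exp (t • v) * a ^ (1 / 2 : ℝ) where
  contDiffOn := by
    have := contDiff_exp_smul v 2
    exact ((contDiff_const.mul this).mul contDiff_const).contDiffOn
  pos t _ := isStrictlyPositive_exp_conj ha hv t
  covDeriv_eq_zero t ht := by
    set p := a ^ (1 / 2 : ℝ) with hp
    set q := a ^ (-(1 / 2) : ℝ) with hq
    have hpq : p * q = 1 := rpow_half_mul_rpow_neg_half ha
    have hqp : q * p = 1 := rpow_neg_half_mul_rpow_half ha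
    have h1 : ∀ s ∈ I, derivWithin (fun t : ℝ => p * NormedSpace.exp (t • v) * p) I s =
        p * (NormedSpace.exp (s • v) * v) * p := fun s hs =>
      (hasDerivAt_exp_conj p v s).hasDerivWithinAt.derivWithin (hI s hs)
    have h2 : derivWithin (derivWithin (fun t : ℝ => p * NormedSpace.exp (t • v) * p) I) I t =
        p * (NormedSpace.exp (t • v) * v * v) * p := by
      rw [derivWithin_congr h1 (h1 t ht)]
      exact ((((hasDerivAt_exp_smul_const v t).mul_const v).const_mul p).mul_const
        p).hasDerivWithinAt.derivWithin (hI t ht)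
    set E := NormedSpace.exp (t • v) with hE
    set F := NormedSpace.exp (-(t • v)) with hF
    have hEF : E * F = 1 := exp_mul_exp_neg _
    have hFE : F * E = 1 := by simpa [hE, hF] using exp_mul_exp_neg (-(t • v))
    have hinv : (p * E * p)⁻¹ʳ = q * F * q := by
      refine ringInverse_eq_of_mul_eq_one ?_ ?_ <;>
      · simp only [mul_assoc]
        simp only [← mul_assoc p q, ← mul_assoc q p, ← mul_assoc E F, ← mul_assoc F E, hpq, hqp,
          hEF, hFE, one_mul]
    rw [covDeriv, h2, h1 t ht, hinv]
    -- Both terms of the connection are equal to `γ''`.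
    have : p * (E * v) * p * (q * F * q) * (p * (E * v) * p) = p * (E * v * v) * p := by
      simp only [mul_assoc]
      simp only [← mul_assoc p q, ← mul_assoc q p, ← mul_assoc F E, hpq, hqp, hFE, one_mul]
    rw [this, ← two_smul ℝ (p * (E * v * v) * p), smul_smul]
    norm_num

lemma isGeodesicOn_geoMean {a b : M2 A} (ha : IsStrictlyPositive a) (hb : IsStrictlyPositive b)
    {I : Set ℝ} (hI : UniqueDiffOn ℝ I) : IsGeodesicOn I (geoMean a b) := by
  rw [funext (geoMean_eq_exp ha hb)]
  exact isGeodesicOn_exp_conj ha IsSelfAdjoint.log hI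

/-! ### Geodesics, convexity of the distance, and the Finsler length -/

lemma isSelfAdjoint_derivWithin {γ : ℝ → M2 A} {I : Set ℝ}
    (h : ∀ t ∈ I, IsStrictlyPositive (γ t)) {t : ℝ} (ht : t ∈ I) :
    IsSelfAdjoint (derivWithin γ I t) := by
  have h1 : ∀ s ∈ I, (fun y => star (γ y)) s = γ s := fun s hs => (h s hs).isSelfAdjoint.star_eq
  rw [IsSelfAdjoint, ← derivWithin.star, derivWithin_congr h1 (h1 t ht)]

lemma isSelfAdjoint_rpow_conj {a x : M2 A} (hx : IsSelfAdjoint x) (s : ℝ) :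
    IsSelfAdjoint (a ^ s * x * a ^ s) := by
  rw [IsSelfAdjoint, star_mul, star_mul, star_rpow_eq, hx.star_eq, mul_assoc]

lemma subsingleton_or_uniqueDiffOn {I : Set ℝ} (hI : I.OrdConnected) :
    I.Subsingleton ∨ UniqueDiffOn ℝ I := by
  by_cases h : I.Subsingleton
  · exact Or.inl h
  · obtain ⟨x, hx, y, hy, hxy⟩ := (Set.not_subsingleton_iff.1 h).exists_lt
    refine Or.inr (uniqueDiffOn_convex hI.convex ?_)
    refine (Set.nonempty_Ioo.2 hxy).mono ?_
    rw [← interior_Icc]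
    exact interior_mono (hI.out hx hy)

namespace IsGeodesicOn

variable {I : Set ℝ} {γ : ℝ → M2 A}

/-- The geodesic equation `γ'' = γ' γ⁻¹ γ'` says that `v = γ⁻¹ γ'` is constant, so that `γ' = γ v`
is solved by exponentials. -/
lemma eq_mul_exp (hγ : IsGeodesicOn I γ) (hI : I.OrdConnected) {s t : ℝ} (hs : s ∈ I)
    (ht : t ∈ I) :
    γ t = γ s * NormedSpace.exp ((t - s) • ((γ s)⁻¹ʳ * derivWithin γ I s)) := by
  -- On a one-point interval `derivWithin` is the junk value `0`, and the formula is trivial.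
  obtain hsub | hU := subsingleton_or_uniqueDiffOn hI
  · rw [hsub ht hs, sub_self, zero_smul, NormedSpace.exp_zero, mul_one]
  have hd : ∀ x ∈ I, HasDerivWithinAt γ (derivWithin γ I x) I x := fun x hx =>
    (hγ.contDiffOn.differentiableOn (by norm_num) x hx).hasDerivWithinAt
  have hd2 : ∀ x ∈ I, HasDerivWithinAt (derivWithin γ I)
      (derivWithin γ I x * (γ x)⁻¹ʳ * derivWithin γ I x) I x := by
    intro x hx
    have h1 : ContDiffOn ℝ 1 (derivWithin γ I) I :=
      hγ.contDiffOn.derivWithin hU (by norm_num)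
    have h2 := (h1.differentiableOn (by norm_num) x hx).hasDerivWithinAt
    have h3 := hγ.covDeriv_eq_zero x hx
    rw [covDeriv, ← two_smul ℝ (derivWithin γ I x * (γ x)⁻¹ʳ * derivWithin γ I x), smul_smul,
      sub_eq_zero] at h3
    norm_num at h3
    rwa [h3] at h2
  have hinv : ∀ x ∈ I, HasDerivWithinAt (fun y => (γ y)⁻¹ʳ)
      (-((γ x)⁻¹ʳ * derivWithin γ I x * (γ x)⁻¹ʳ)) I x := by
    intro x hx
    obtain ⟨u, hu⟩ := (hγ.pos x hx).isUnit
    have h1 := hasFDerivAt_ringInverse (𝕜 := ℝ) u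
    rw [hu] at h1
    have h2 := h1.comp_hasDerivWithinAt x (hd x hx)
    convert! h2 using 1
    rw [← hu, Ring.inverse_unit]
    simp
  have hconst : ∀ {f : ℝ → M2 A}, (∀ x ∈ I, HasDerivWithinAt f 0 I x) → ∀ x ∈ I, ∀ y ∈ I,
      f x = f y := by
    intro f hf x hx y hy
    refine hI.convex.is_const_of_fderivWithin_eq_zero (𝕜 := ℝ)
      (fun z hz => (hf z hz).differentiableWithinAt) (fun z hz => ?_) hx hy
    have := (hf z hz).hasFDerivWithinAt.fderivWithin (hU z hz)
    rw [this]
    ext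
    simp
  -- `v` is constant because `(γ⁻¹)' = -γ⁻¹ γ' γ⁻¹` cancels against `γ⁻¹ γ''`.
  set v := (γ s)⁻¹ʳ * derivWithin γ I s with hv
  have hvel : ∀ x ∈ I, derivWithin γ I x = γ x * v := by
    intro x hx
    have h1 : (γ x)⁻¹ʳ * derivWithin γ I x = v := by
      refine hconst (f := fun y => (γ y)⁻¹ʳ * derivWithin γ I y) (fun z hz => ?_) x hx s hs
      refine ((hinv z hz).mul (hd2 z hz)).congr_deriv ?_
      noncomm_ring
    rw [← h1, ← mul_assoc, Ring.mul_inverse_cancel _ (hγ.pos x hx).isUnit, one_mul]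
  have hw : γ t * NormedSpace.exp ((t - s) • (-v)) = γ s * NormedSpace.exp ((s - s) • (-v)) := by
    refine hconst (f := fun y => γ y * NormedSpace.exp ((y - s) • (-v))) (fun z hz => ?_) t ht s hs
    have h1 : HasDerivAt (fun y : ℝ => NormedSpace.exp ((y - s) • (-v)))
        (-v * NormedSpace.exp ((z - s) • (-v))) z := by
      have := (hasDerivAt_exp_smul_const' (-v) (z - s)).scomp z ((hasDerivAt_id z).sub_const s)
      simpa [Function.comp_def] using this
    refine ((hd z hz).mul h1.hasDerivWithinAt).congr_deriv ?_
    rw [hvel z hz]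
    noncomm_ring
  rw [sub_self, zero_smul, NormedSpace.exp_zero, mul_one, smul_neg] at hw
  have hE : NormedSpace.exp (-((t - s) • v)) * NormedSpace.exp ((t - s) • v) = 1 := by
    simpa using exp_mul_exp_neg (-((t - s) • v))
  rw [← hw, mul_assoc, hE, mul_one]

lemma eq_exp_conj (hγ : IsGeodesicOn I γ) (hI : I.OrdConnected) {s t : ℝ} (hs : s ∈ I)
    (ht : t ∈ I) :
    γ t = γ s ^ (1 / 2 : ℝ) * NormedSpace.exp ((t - s) •
      (γ s ^ (-(1 / 2) : ℝ) * derivWithin γ I s * γ s ^ (-(1 / 2) : ℝ))) * γ s ^ (1 / 2 : ℝ) := by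
  have ha := hγ.pos s hs
  have hpq := rpow_half_mul_rpow_neg_half ha
  have hqp := rpow_neg_half_mul_rpow_half ha
  have h1 : (t - s) • ((γ s)⁻¹ʳ * derivWithin γ I s) = γ s ^ (-(1 / 2) : ℝ) * ((t - s) •
      (γ s ^ (-(1 / 2) : ℝ) * derivWithin γ I s * γ s ^ (-(1 / 2) : ℝ))) * γ s ^ (1 / 2 : ℝ) := by
    rw [mul_smul_comm, smul_mul_assoc, ← rpow_neg_half_mul_self ha]
    simp only [mul_assoc, hqp, mul_one]
  rw [hγ.eq_mul_exp hI hs ht, h1, exp_conj_of_mul_eq_one hqp hpq]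
  nth_rw 1 [← rpow_half_mul_rpow_half ha]
  simp only [mul_assoc]
  rw [← mul_assoc (γ s ^ (1 / 2 : ℝ)) (γ s ^ (-(1 / 2) : ℝ)), hpq, one_mul]

lemma isSelfAdjoint_velocity (hγ : IsGeodesicOn I γ) {s : ℝ} (hs : s ∈ I) :
    IsSelfAdjoint (γ s ^ (-(1 / 2) : ℝ) * derivWithin γ I s * γ s ^ (-(1 / 2) : ℝ)) :=
  isSelfAdjoint_rpow_conj (isSelfAdjoint_derivWithin hγ.pos hs) _

lemma dg_eq (hγ : IsGeodesicOn I γ) (hI : I.OrdConnected) {s t : ℝ} (hs : s ∈ I) (ht : t ∈ I) :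
    dg (γ s) (γ t) = |t - s| * finslerNorm (γ s) (derivWithin γ I s) := by
  rw [hγ.eq_exp_conj hI hs ht, dg_exp (hγ.pos s hs)
    ((IsSelfAdjoint.all _).smul (hγ.isSelfAdjoint_velocity hs)), norm_smul, Real.norm_eq_abs,
    finslerNorm]

/-- Geodesics have constant speed. -/
lemma finslerNorm_eq (hγ : IsGeodesicOn I γ) (hI : I.OrdConnected) {s t : ℝ} (hs : s ∈ I)
    (ht : t ∈ I) :
    finslerNorm (γ t) (derivWithin γ I t) = finslerNorm (γ s) (derivWithin γ I s) := by
  obtain rfl | hne := eq_or_ne s t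
  · rfl
  have h := hγ.dg_eq hI ht hs
  rw [dg_comm (hγ.pos t ht) (hγ.pos s hs), hγ.dg_eq hI hs ht, abs_sub_comm s t] at h
  exact (mul_left_cancel₀ (abs_pos.2 (sub_ne_zero.2 hne.symm)).ne' h).symm

/-- A geodesic is, between any two of its points, the curve of weighted geometric means. -/
lemma eq_geoMean (hγ : IsGeodesicOn I γ) (hI : I.OrdConnected) {s u : ℝ} (hs : s ∈ I)
    (hu : u ∈ I) {t : ℝ} (ht : s + t * (u - s) ∈ I) :
    γ (s + t * (u - s)) = geoMean (γ s) (γ u) t := by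
  have ha := hγ.pos s hs
  rw [geoMean_eq_exp ha (hγ.pos u hu), hγ.eq_exp_conj hI hs ht]
  congr 3
  have h1 : γ s ^ (-(1 / 2) : ℝ) * γ u * γ s ^ (-(1 / 2) : ℝ) = NormedSpace.exp ((u - s) •
      (γ s ^ (-(1 / 2) : ℝ) * derivWithin γ I s * γ s ^ (-(1 / 2) : ℝ))) := by
    rw [hγ.eq_exp_conj hI hs hu, rpow_neg_half_conj_rpow_half_conj ha]
  rw [h1, CFC.log_exp _ ((IsSelfAdjoint.all _).smul (hγ.isSelfAdjoint_velocity hs)), smul_smul,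
    add_sub_cancel_left]

lemma finslerLength_eq {γ : ℝ → M2 A} (hγ : IsGeodesicOn (Set.Icc 0 1) γ) :
    finslerLength γ = dg (γ 0) (γ 1) := by
  have h0 : (0 : ℝ) ∈ Set.Icc (0 : ℝ) 1 := by simp
  have h1 : (1 : ℝ) ∈ Set.Icc (0 : ℝ) 1 := by simp
  rw [hγ.dg_eq Set.ordConnected_Icc h0 h1, finslerLength,
    intervalIntegral.integral_congr (g := fun _ =>
      finslerNorm (γ 0) (derivWithin γ (Set.Icc 0 1) 0))]
  · simp
  · intro t ht
    rw [Set.uIcc_of_le zero_le_one] at ht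
    exact hγ.finslerNorm_eq Set.ordConnected_Icc h0 ht

end IsGeodesicOn

lemma geoMean_symm {a b : M2 A} (ha : IsStrictlyPositive a) (hb : IsStrictlyPositive b)
    (t : ℝ) : geoMean b a (1 - t) = geoMean a b t := by
  have h := (isGeodesicOn_geoMean ha hb uniqueDiffOn_univ).eq_geoMean Set.ordConnected_univ
    (Set.mem_univ 1) (Set.mem_univ 0) (t := 1 - t) (Set.mem_univ _)
  rw [geoMean_zero ha hb, geoMean_one ha hb] at h
  rw [← h]
  congr 1
  ring

/-- Two geodesic segments are compared through the segment joining the origin of the first to the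
end of the second. -/
lemma dg_geoMean_geoMean_le {a b c d : M2 A} (ha : IsStrictlyPositive a)
    (hb : IsStrictlyPositive b) (hc : IsStrictlyPositive c) (hd : IsStrictlyPositive d) {t : ℝ}
    (ht : t ∈ Set.Icc (0 : ℝ) 1) :
    dg (geoMean a b t) (geoMean c d t) ≤ (1 - t) * dg a c + t * dg b d := by
  have h1 := dg_geoMean_le ha hb hd ht
  have h2 := dg_geoMean_le hd ha hc (t := 1 - t) ⟨by linarith [ht.2], by linarith [ht.1]⟩
  rw [geoMean_symm ha hd, geoMean_symm hc hd] at h2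
  have h3 := dg_triangle (isStrictlyPositive_geoMean ha hb t) (isStrictlyPositive_geoMean ha hd t)
    (isStrictlyPositive_geoMean hc hd t)
  linarith

lemma convexOn_dg {I : Set ℝ} (hI : I.OrdConnected) {γ₁ γ₂ : ℝ → M2 A} (h₁ : IsGeodesicOn I γ₁)
    (h₂ : IsGeodesicOn I γ₂) : ConvexOn ℝ I fun t => dg (γ₁ t) (γ₂ t) := by
  refine ⟨hI.convex, fun x hx y hy a b ha hb hab => ?_⟩
  obtain rfl : a = 1 - b := by linarith
  have hmem : x + b * (y - x) ∈ I := by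
    convert hI.convex hx hy ha hb hab using 1
    simp only [smul_eq_mul]
    ring
  have e : (1 - b) • x + b • y = x + b * (y - x) := by
    simp only [smul_eq_mul]
    ring
  simp only [e]
  rw [h₁.eq_geoMean hI hx hy hmem, h₂.eq_geoMean hI hx hy hmem]
  exact dg_geoMean_geoMean_le (h₁.pos x hx) (h₁.pos y hy) (h₂.pos x hx) (h₂.pos y hy)
    ⟨hb, by linarith⟩

lemma self_le_finslerNorm_smul {a x : M2 A} (ha : IsStrictlyPositive a) (hx : IsSelfAdjoint x) :
    x ≤ finslerNorm a x • a := by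
  have h := rpow_conj_le (le_norm_smul_one (isSelfAdjoint_rpow_conj (a := a) hx (-(1 / 2)))) a
    (1 / 2)
  rwa [rpow_half_conj_rpow_neg_half_conj ha, mul_smul_comm, smul_mul_assoc, mul_one,
    rpow_half_mul_rpow_half ha] at h

lemma neg_le_finslerNorm_smul {a x : M2 A} (ha : IsStrictlyPositive a) (hx : IsSelfAdjoint x) :
    -x ≤ finslerNorm a x • a := by
  have h := self_le_finslerNorm_smul ha hx.neg
  rwa [finslerNorm, mul_neg, neg_mul, norm_neg] at h

/-- The Finsler length of a curve bounds the distance of its ends. With `F` the arc length, the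
curves `exp F • γ` and `-exp (-F) • γ` have positive velocity. -/
lemma dg_le_finslerLength {γ : ℝ → M2 A} (hγ : ContDiffOn ℝ 1 γ (Set.Icc 0 1))
    (hpos : ∀ t ∈ Set.Icc (0 : ℝ) 1, IsStrictlyPositive (γ t)) :
    dg (γ 0) (γ 1) ≤ finslerLength γ := by
  have h0 : (0 : ℝ) ∈ Set.Icc (0 : ℝ) 1 := by simp
  have h1 : (1 : ℝ) ∈ Set.Icc (0 : ℝ) 1 := by simp
  set f : ℝ → ℝ := fun t => finslerNorm (γ t) (derivWithin γ (Set.Icc 0 1) t) with hf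
  have hγc : ContinuousOn γ (Set.Icc 0 1) := hγ.continuousOn
  have hγ'c : ContinuousOn (derivWithin γ (Set.Icc 0 1)) (Set.Icc 0 1) :=
    hγ.continuousOn_derivWithin (uniqueDiffOn_Icc zero_lt_one) le_rfl
  have hfc : ContinuousOn f (Set.Icc 0 1) := by
    have hr := continuousOn_rpow_comp hγc hpos (-(1 / 2))
    exact ((hr.mul hγ'c).mul hr).norm
  have hd : ∀ t ∈ Set.Ioo (0 : ℝ) 1, HasDerivAt γ (derivWithin γ (Set.Icc 0 1) t) t := by
    intro t ht
    have := hγ.differentiableOn one_ne_zero t (Set.Ioo_subset_Icc_self ht)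
    exact this.hasDerivWithinAt.hasDerivAt (Icc_mem_nhds ht.1 ht.2)
  have hfi : ∀ t ∈ Set.Icc (0 : ℝ) 1, IntervalIntegrable f MeasureTheory.volume 0 t := by
    intro t ht
    refine ContinuousOn.intervalIntegrable (hfc.mono ?_)
    rw [Set.uIcc_of_le ht.1]
    exact Set.Icc_subset_Icc_right ht.2
  set F : ℝ → ℝ := fun t => ∫ x in (0 : ℝ)..t, f x with hF
  have hFd : ∀ t ∈ Set.Ioo (0 : ℝ) 1, HasDerivAt F (f t) t := by
    intro t ht
    refine intervalIntegral.integral_hasDerivAt_right (hfi t (Set.Ioo_subset_Icc_self ht)) ?_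
      (hfc.continuousAt (Icc_mem_nhds ht.1 ht.2))
    exact (hfc.mono Set.Ioo_subset_Icc_self).stronglyMeasurableAtFilter isOpen_Ioo t ht
  have hFc : ContinuousOn F (Set.Icc 0 1) := by
    have := intervalIntegral.continuousOn_primitive_interval (f := f) (a := 0) (b := 1)
      (μ := MeasureTheory.volume) (by
        rw [Set.uIcc_of_le zero_le_one]
        exact hfc.integrableOn_Icc)
    rwa [Set.uIcc_of_le zero_le_one] at this
  have hF0 : F 0 = 0 := intervalIntegral.integral_same
  have hF1 : F 1 = finslerLength γ := rfl
  have hsa : ∀ t ∈ Set.Icc (0 : ℝ) 1, IsSelfAdjoint (derivWithin γ (Set.Icc 0 1) t) :=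
    fun t ht => isSelfAdjoint_derivWithin hpos ht
  have hL : 0 ≤ finslerLength γ :=
    intervalIntegral.integral_nonneg zero_le_one fun t _ => norm_nonneg _
  have key1 : Real.exp (F 0) • γ 0 ≤ Real.exp (F 1) • γ 1 := by
    refine le_of_hasDerivAt_nonneg (g := fun t => Real.exp (F t) • γ t)
      (g' := fun t => Real.exp (F t) • (f t • γ t + derivWithin γ (Set.Icc 0 1) t))
      (hFc.rexp.smul hγc) (hFc.rexp.smul ((hfc.smul hγc).add hγ'c)) (fun t ht => ?_)
      (fun t ht => ?_)
    · refine ((hFd t ht).exp.smul (hd t ht)).congr_deriv ?_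
      module
    · refine smul_nonneg (Real.exp_pos _).le ?_
      rw [← neg_le_iff_add_nonneg]
      exact neg_le_finslerNorm_smul (hpos t ht) (hsa t ht)
  have key2 : -(Real.exp (-F 0) • γ 0) ≤ -(Real.exp (-F 1) • γ 1) := by
    refine le_of_hasDerivAt_nonneg (g := fun t => -(Real.exp (-F t) • γ t))
      (g' := fun t => Real.exp (-F t) • (f t • γ t - derivWithin γ (Set.Icc 0 1) t))
      (hFc.neg.rexp.smul hγc).neg (hFc.neg.rexp.smul ((hfc.smul hγc).sub hγ'c)) (fun t ht => ?_)
      (fun t ht => ?_)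
    · refine ((hFd t ht).neg.exp.smul (hd t ht)).neg.congr_deriv ?_
      module
    · refine smul_nonneg (Real.exp_pos _).le ?_
      rw [sub_nonneg]
      exact self_le_finslerNorm_smul (hpos t ht) (hsa t ht)
  rw [hF0, hF1, Real.exp_zero, one_smul] at key1
  rw [hF0, hF1, neg_zero, Real.exp_zero, one_smul, neg_le_neg_iff] at key2
  rw [dg_le_iff (hpos 0 h0) (hpos 1 h1) hL]
  refine ⟨?_, key1⟩
  have := smul_le_smul_of_nonneg_left key2 (Real.exp_pos (finslerLength γ)).le
  rwa [smul_smul, ← Real.exp_add, add_neg_cancel, Real.exp_zero, one_smul] at this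

/-! ### Totally geodesic sets of positive matrices -/

/-- The positive `a` with `a ρ a = ρ`, for a symmetry `ρ`, are the fixed points of the isometric
involution `a ↦ ρ a⁻¹ ρ`, and they form a totally geodesic set. In the proof, with `p = a ^ (1 / 2)`
and `p⁻¹ b p⁻¹ = exp V`, the element `p ρ p` is a symmetry which conjugates `exp V` to `exp (-V)`,
hence `V` to `-V`. -/
lemma geoMean_mul_mul_geoMean {ρ a b : M2 A} (hρ : ρ * ρ = 1) (hρs : star ρ = ρ)
    (ha : IsStrictlyPositive a) (hb : IsStrictlyPositive b) (haρ : a * ρ * a = ρ)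
    (hbρ : b * ρ * b = ρ) (t : ℝ) : geoMean a b t * ρ * geoMean a b t = ρ := by
  set V := CFC.log (a ^ (-(1 / 2) : ℝ) * b * a ^ (-(1 / 2) : ℝ)) with hV
  have hVs : IsSelfAdjoint V := IsSelfAdjoint.log
  have hbe : a ^ (1 / 2 : ℝ) * NormedSpace.exp V * a ^ (1 / 2 : ℝ) = b := by
    have h := geoMean_eq_exp ha hb 1
    rwa [geoMean_one ha hb, one_smul, eq_comm] at h
  rw [geoMean_eq_exp ha hb, ← hV]
  set p := a ^ (1 / 2 : ℝ) with hp
  set q := a ^ (-(1 / 2) : ℝ) with hq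
  have hpp : p * p = a := rpow_half_mul_rpow_half ha
  have hpq : p * q = 1 := rpow_half_mul_rpow_neg_half ha
  have hqp : q * p = 1 := rpow_neg_half_mul_rpow_half ha
  have hps : star p = p := star_rpow_eq a _
  obtain ⟨s, hs⟩ : ∃ s, s = p * ρ * p := ⟨_, rfl⟩
  have hss : star s = s := by rw [hs, star_mul, star_mul, hps, hρs, mul_assoc]
  have hs1 : s * s = 1 := by
    have h1 : ρ * (p * p) * ρ = q * q := by
      calc ρ * (p * p) * ρ = ρ * (p * p) * ρ * (p * (p * q) * q) := by
            rw [hpq, mul_one, hpq, mul_one]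
        _ = ρ * ((p * p) * ρ * (p * p)) * (q * q) := by simp only [mul_assoc]
        _ = q * q := by rw [hpp, haρ, hρ, one_mul]
    calc s * s = p * (ρ * (p * p) * ρ) * p := by rw [hs]; simp only [mul_assoc]
      _ = (p * q) * (q * p) := by rw [h1]; simp only [mul_assoc]
      _ = 1 := by rw [hpq, hqp, one_mul]
  have hqs : q * ρ * q = s := by
    calc q * ρ * q = q * ρ * q * (s * s) := by rw [hs1, mul_one]
      _ = q * (ρ * ((q * p) * ρ)) * p * s := by rw [hs]; simp only [mul_assoc]
      _ = s := by rw [hqp, one_mul, hρ, mul_one, hqp, one_mul]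
  have hEs : NormedSpace.exp V * s * NormedSpace.exp V = s := by
    calc NormedSpace.exp V * s * NormedSpace.exp V
        = (q * p) * (NormedSpace.exp V * s * NormedSpace.exp V) * (p * q) := by
          rw [hqp, hpq, one_mul, mul_one]
      _ = q * ((p * NormedSpace.exp V * p) * ρ * (p * NormedSpace.exp V * p)) * q := by
          rw [hs]; simp only [mul_assoc]
      _ = s := by rw [hbe, hbρ, hqs]
  have hneg : s * V * s = -V := by
    refine eq_of_exp_eq ?_ hVs.neg ?_
    · rw [IsSelfAdjoint, star_mul, star_mul, hss, hVs.star_eq, mul_assoc]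
    · rw [exp_conj_of_mul_eq_one hs1 hs1]
      calc s * NormedSpace.exp V * s
          = s * NormedSpace.exp V * s * (NormedSpace.exp V * NormedSpace.exp (-V)) := by
            rw [exp_mul_exp_neg, mul_one]
        _ = s * (NormedSpace.exp V * s * NormedSpace.exp V) * NormedSpace.exp (-V) := by
            simp only [mul_assoc]
        _ = NormedSpace.exp (-V) := by rw [hEs, hs1, one_mul]
  have hEt : NormedSpace.exp (t • V) * s * NormedSpace.exp (t • V) = s := by
    have h1 : s * NormedSpace.exp (t • V) * s = NormedSpace.exp (-(t • V)) := by
      rw [← exp_conj_of_mul_eq_one hs1 hs1, mul_smul_comm, smul_mul_assoc, hneg, smul_neg]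
    calc NormedSpace.exp (t • V) * s * NormedSpace.exp (t • V)
        = NormedSpace.exp (t • V) * (s * NormedSpace.exp (t • V) * s) * s := by
          simp only [mul_assoc, hs1, mul_one]
      _ = s := by rw [h1, exp_mul_exp_neg, one_mul]
  calc p * NormedSpace.exp (t • V) * p * ρ * (p * NormedSpace.exp (t • V) * p)
      = p * (NormedSpace.exp (t • V) * s * NormedSpace.exp (t • V)) * p := by
        rw [hs]; simp only [mul_assoc]
    _ = (p * p) * ρ * (p * p) := by rw [hEt, hs]; simp only [mul_assoc]
    _ = ρ := by rw [hpp, haρ]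

lemma finslerNorm_nonneg (a x : M2 A) : 0 ≤ finslerNorm a x := norm_nonneg _

/-- The geometry of a set embedded in the positive invertible matrices, when the image of the
embedding is closed under weighted geometric means. -/
theorem isNonposCurvedLengthSpace_of_embedding {X : Type*} {e : X → M2 A}
    {IsCurve : (ℝ → X) → Prop} (hpos : ∀ x, IsStrictlyPositive (e x))
    (hinj : Function.Injective e)
    (hgeo : ∀ x y t, ∃ z, e z = geoMean (e x) (e y) t)
    (hcurve : ∀ c, IsCurve c ↔ ContDiffOn ℝ 1 (fun t => e (c t)) (Set.Icc 0 1)) :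
    IsNonposCurvedLengthSpace (fun x y => dg (e x) (e y))
      (fun I δ => IsGeodesicOn I fun t => e (δ t)) IsCurve
      (fun c => finslerLength fun t => e (c t)) := by
  have hex : ∀ x y : X, ∃ δ : ℝ → X,
      IsGeodesicOn (Set.Icc 0 1) (fun t => e (δ t)) ∧ δ 0 = x ∧ δ 1 = y := by
    intro x y
    choose δ hδ using hgeo x y
    refine ⟨δ, ?_, hinj ?_, hinj ?_⟩
    · rw [funext hδ]
      exact isGeodesicOn_geoMean (hpos x) (hpos y) (uniqueDiffOn_Icc zero_lt_one)
    · rw [hδ, geoMean_zero (hpos x) (hpos y)]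
    · rw [hδ, geoMean_one (hpos x) (hpos y)]
  have h0 : (0 : ℝ) ∈ Set.Icc (0 : ℝ) 1 := by simp
  have h1 : (1 : ℝ) ∈ Set.Icc (0 : ℝ) 1 := by simp
  refine ⟨?_, ?_, fun δ hδ =>
    IsGeodesicOn.finslerLength_eq (γ := fun t => e (δ t)) hδ, hex,
    fun I δ₁ δ₂ hI h₁ h₂ => convexOn_dg hI h₁ h₂, fun I δ₁ δ₂ hI hsub h₁ h₂ h t ht => ?_⟩
  · let M : MetricSpace X :=
      { dist := fun x y => dg (e x) (e y)
        dist_self := fun x => dg_self (hpos x)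
        dist_comm := fun x y => dg_comm (hpos x) (hpos y)
        dist_triangle := fun x y z => dg_triangle (hpos x) (hpos y) (hpos z)
        eq_of_dist_eq_zero := fun {x y} h => hinj (eq_of_dg_eq_zero (hpos x) (hpos y) h) }
    have hdist : ∀ x y : X, dist x y = dg (e x) (e y) := fun _ _ => rfl
    have hlip : ∀ {I : Set ℝ} {δ : ℝ → X}, I.OrdConnected →
        IsGeodesicOn I (fun t => e (δ t)) → ∀ s ∈ I,
        LipschitzOnWith (finslerNorm (e (δ s)) (derivWithin (fun t => e (δ t)) I s)).toNNReal
          δ I := by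
      intro I δ hI hδ s hs
      refine LipschitzOnWith.of_dist_le_mul fun u hu v hv => ?_
      rw [hdist, hδ.dg_eq hI hu hv, hδ.finslerNorm_eq hI hs hu,
        Real.coe_toNNReal _ (finslerNorm_nonneg _ _), Real.dist_eq, abs_sub_comm, mul_comm]
    have hvar : ∀ {I : Set ℝ} {δ : ℝ → X}, I.OrdConnected →
        IsGeodesicOn I (fun t => e (δ t)) → ∀ s ∈ I, ∀ t ∈ I, s ≤ t →
        eVariationOn δ (Set.Icc s t) = edist (δ s) (δ t) := by
      intro I δ hI hδ s hs t ht hst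
      refine le_antisymm ?_ (eVariationOn.edist_le δ (Set.left_mem_Icc.2 hst)
        (Set.right_mem_Icc.2 hst))
      have hL := ((hlip hI hδ s hs).mono (hI.out hs ht)).comp_eVariationOn_le
        (g := id) (s := Set.Icc s t) (Set.mapsTo_id _)
      have hid : eVariationOn (id : ℝ → ℝ) (Set.Icc s t) = ENNReal.ofReal (t - s) := by
        have := (monotone_id.monotoneOn (Set.Icc s t)).eVariationOn_eq
          (Set.left_mem_Icc.2 hst) (Set.right_mem_Icc.2 hst)
        rwa [Set.inter_self] at this
      refine hL.trans ?_
      rw [hid, edist_dist, hdist, hδ.dg_eq hI hs ht, abs_of_nonneg (sub_nonneg.2 hst), mul_comm,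
        ENNReal.ofReal_mul (sub_nonneg.2 hst)]
      rfl
    refine ⟨M, hdist, fun x y => le_antisymm ?_ ?_, fun I δ hI hδ => hvar hI hδ⟩
    · refine le_iInf₂ fun c hc => ?_
      rw [← hc.2.1, ← hc.2.2]
      exact eVariationOn.edist_le c h0 h1
    · obtain ⟨δ, hδ, rfl, rfl⟩ := hex x y
      refine (iInf₂_le δ ⟨(hlip Set.ordConnected_Icc hδ 0 h0).continuousOn, rfl, rfl⟩).trans ?_
      exact (hvar Set.ordConnected_Icc hδ 0 h0 1 h1 zero_le_one).le
  · intro x y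
    constructor
    · obtain ⟨δ, hδ, rfl, rfl⟩ := hex x y
      exact ⟨δ, (hcurve δ).2 (hδ.contDiffOn.of_le (by norm_num)), rfl, rfl,
        IsGeodesicOn.finslerLength_eq (γ := fun t => e (δ t)) hδ⟩
    · rintro _ ⟨c, hc, rfl, rfl, rfl⟩
      exact dg_le_finslerLength (γ := fun t => e (c t)) ((hcurve c).1 hc) fun t _ => hpos _
  · have hc := (convexOn_dg hI h₁ h₂).2 (hsub h0) (hsub h1) (sub_nonneg.2 ht.2) ht.1
      (sub_add_cancel 1 t)
    simp only [smul_eq_mul, mul_zero, mul_one, zero_add] at hc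
    rwa [h, dg_self (hpos _), mul_zero, zero_add] at hc

end

/-! ### Entries of matrices over a C⋆-algebra -/

section

variable {A : Type*}

lemma M2_ext {a b : M2 A} (h : ∀ i j, toM a i j = toM b i j) : a = b :=
  CStarMatrix.ofMatrix.symm.injective (Matrix.ext h)

lemma toM_ofM (M : Matrix (Fin 2) (Fin 2) A) : toM (ofM M) = M := rfl

end

variable {A : Type*} [CStarAlgebra A] [PartialOrder A] [StarOrderedRing A]

lemma toM_sub (a b : M2 A) : toM (a - b) = toM a - toM b := rfl

lemma toM_mul_apply (a b : M2 A) (i j : Fin 2) :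
    toM (a * b) i j = toM a i 0 * toM b 0 j + toM a i 1 * toM b 1 j := by
  rw [toM_mul, Matrix.mul_apply, Fin.sum_univ_two]

/-- The `(i, j)` entry, as a continuous linear map. -/
def entryL (i j : Fin 2) : M2 A →L[ℂ] A where
  toFun a := toM a i j
  map_add' _ _ := rfl
  map_smul' _ _ := rfl
  cont := (continuous_apply_apply (ρ := fun _ _ : Fin 2 => A) i j).comp
    (CStarMatrix.ofMatrixL (m := Fin 2) (n := Fin 2) (A := A)).symm.continuous

/-- The matrix with a single non-zero entry, at `(i, j)`, as a continuous linear map. -/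
def singleL (i j : Fin 2) : A →L[ℂ] M2 A where
  toFun x := ofM (Matrix.single i j x)
  map_add' x y := congrArg ofM (Matrix.single_add i j x y)
  map_smul' c x := congrArg ofM (Matrix.smul_single c i j x).symm
  cont := (CStarMatrix.ofMatrixL (m := Fin 2) (n := Fin 2) (A := A)).continuous.comp
    (continuous_matrix fun k l => by
      change Continuous fun x : A => Matrix.single i j x k l
      by_cases h : i = k ∧ j = l
      · simp only [Matrix.single_apply, if_pos h]
        exact continuous_id
      · simp only [Matrix.single_apply, if_neg h]
        exact continuous_const)

lemma sum_singleL (a : M2 A) : ∑ i, ∑ j, singleL i j (toM a i j) = a :=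
  congrArg ofM (Matrix.matrix_eq_sum_single (toM a)).symm

lemma contDiffOn_M2_iff {n : WithTop ℕ∞} {f : ℝ → M2 A} {I : Set ℝ} :
    ContDiffOn ℝ n f I ↔ ∀ i j, ContDiffOn ℝ n (fun t => toM (f t) i j) I := by
  constructor
  · intro h i j
    exact ((entryL (A := A) i j).restrictScalars ℝ).contDiff.comp_contDiffOn h
  · intro h
    have : f = fun t => ∑ i, ∑ j, singleL i j (toM (f t) i j) :=
      funext fun t => (sum_singleL (f t)).symm
    rw [this]
    exact ContDiffOn.sum fun i _ => ContDiffOn.sum fun j _ =>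
      ((singleL (A := A) i j).restrictScalars ℝ).contDiff.comp_contDiffOn (h i j)

lemma contDiffOn_ringInverse {B : Type*} [CStarAlgebra B] {E : Type*}
    [NormedAddCommGroup E] [NormedSpace ℝ E] {n : WithTop ℕ∞} {f : E → B} {s : Set E}
    (hf : ContDiffOn ℝ n f s) (h : ∀ t ∈ s, IsUnit (f t)) :
    ContDiffOn ℝ n (fun t => (f t)⁻¹ʳ) s := fun t ht =>
  (contDiffAt_ringInverse_of_isUnit (h t ht) n).comp_contDiffWithinAt t (hf t ht)

lemma contDiffOn_star {B : Type*} [CStarAlgebra B] {E : Type*}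
    [NormedAddCommGroup E] [NormedSpace ℝ E] {n : WithTop ℕ∞} {f : E → B} {s : Set E}
    (hf : ContDiffOn ℝ n f s) : ContDiffOn ℝ n (fun t => star (f t)) s :=
  (starL' ℝ (A := B)).contDiff.comp_contDiffOn hf

lemma ofM_vecMulVec_star_nonneg (v : Fin 2 → A) : 0 ≤ ofM (Matrix.vecMulVec v (star v)) := by
  have : ofM (Matrix.vecMulVec v (star v)) =
      ofM !![v 0, 0; v 1, 0] * star (ofM !![v 0, 0; v 1, 0]) := by
    refine M2_ext fun i j => ?_
    rw [toM_mul_apply, toM_star]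
    fin_cases i <;> fin_cases j <;> simp [toM_ofM, Matrix.vecMulVec_apply]
  rw [this]
  exact mul_star_self_nonneg _

lemma toM_apply_self_nonneg {a : M2 A} (ha : 0 ≤ a) (i : Fin 2) : 0 ≤ toM a i i := by
  obtain ⟨b, rfl⟩ := CStarAlgebra.nonneg_iff_eq_mul_star_self.1 ha
  rw [toM_mul_apply]
  exact add_nonneg (mul_star_self_nonneg _) (mul_star_self_nonneg _)

/-! ### The disk -/

lemma rhoD_mul_self : rhoD A * rhoD A = 1 := by
  refine M2_ext fun i j => ?_
  rw [toM_mul_apply, toM_one]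
  fin_cases i <;> fin_cases j <;> simp [rhoD, toM_ofM]

lemma star_rhoD : star (rhoD A) = rhoD A := by
  refine M2_ext fun i j => ?_
  rw [toM_star]
  fin_cases i <;> fin_cases j <;> simp [rhoD, toM_ofM]

lemma rhoD_mul_reflOf (x : Fin 2 → A) :
    rhoD A * reflOf (rhoD A) x = ofM !![x 0 * star (x 0) + x 0 * star (x 0) - 1,
      -(x 0 * star (x 1) + x 0 * star (x 1)); -(x 1 * star (x 0) + x 1 * star (x 0)),
      x 1 * star (x 1) + x 1 * star (x 1) + 1] := by
  refine M2_ext fun i j => ?_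
  rw [reflOf, projOf, two_mul]
  fin_cases i <;> fin_cases j <;>
    simp [toM_mul_apply, toM_sub, toM_add, toM_one, rhoD, toM_ofM, Matrix.vecMulVec_apply]
  all_goals abel

lemma sectionD_zero_mul_star {z : A} (hz : z ∈ openDisk A) :
    sectionD z 0 * star (sectionD z 0) = (1 - star z * z)⁻¹ʳ := by
  have hp : IsStrictlyPositive (1 - star z * z) := isStrictlyPositive_one_sub_star_mul hz
  simp only [sectionD, Matrix.cons_val_zero]
  rw [star_rpow_eq, rpow_neg_half_mul_self hp]

lemma sectionD_one (z : A) : sectionD z 1 = z * sectionD z 0 := by simp [sectionD]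

lemma embD_eq (z : openDisk A) : embD z =
    ofM !![(1 - star (z : A) * z)⁻¹ʳ + (1 - star (z : A) * z)⁻¹ʳ - 1,
      -((1 - star (z : A) * z)⁻¹ʳ * star (z : A) + (1 - star (z : A) * z)⁻¹ʳ * star (z : A));
      -(z * (1 - star (z : A) * z)⁻¹ʳ + z * (1 - star (z : A) * z)⁻¹ʳ),
      z * (1 - star (z : A) * z)⁻¹ʳ * star (z : A) +
        z * (1 - star (z : A) * z)⁻¹ʳ * star (z : A) + 1] := by
  rw [embD, PhiD, rhoD_mul_reflOf, sectionD_one, ← sectionD_zero_mul_star z.2, star_mul]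
  simp only [mul_assoc]

/-- `Φ_D` takes its values in the reflections which preserve the form of `ρ_D`. -/
lemma embD_mul_rhoD_mul_embD (z : openDisk A) : embD z * rhoD A * embD z = rhoD A := by
  obtain ⟨hx, -⟩ := (sectionD_mem z.2).1
  rw [embD, PhiD]
  set x := sectionD (z : A)
  set P : M2 A := ofM (Matrix.vecMulVec x (star x)) with hP
  have hPP : P * rhoD A * P = P := by
    have hx' : star (x 0) * x 0 - star (x 1) * x 1 = 1 := by
      rw [← hx]
      simp only [form, innerA, rhoD, toM_ofM, Matrix.mulVec, dotProduct, Fin.sum_univ_two]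
      simp [sub_eq_add_neg]
    refine M2_ext fun i j => ?_
    have : toM P i j = x i * (star (x 0) * x 0 - star (x 1) * x 1) * star (x j) := by
      rw [hx', mul_one]
      rfl
    rw [this]
    simp only [toM_mul_apply, hP, toM_ofM, Matrix.vecMulVec_apply, Pi.star_apply]
    simp [rhoD, toM_ofM]
    noncomm_ring
  rw [reflOf, projOf, ← hP]
  have h1 : (2 * (P * rhoD A) - 1) * (2 * (P * rhoD A) - 1) = 1 := by
    calc _ = 4 * (P * rhoD A * P * rhoD A) - 4 * (P * rhoD A) + 1 := by noncomm_ring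
      _ = 1 := by rw [hPP, sub_self, zero_add]
  calc _ = rhoD A * ((2 * (P * rhoD A) - 1) * (rhoD A * rhoD A) * (2 * (P * rhoD A) - 1)) := by
        simp only [mul_assoc]
    _ = rhoD A := by rw [rhoD_mul_self, mul_one, h1, mul_one]

lemma isUnit_of_mul_mul_eq {ρ a : M2 A} (hρ : ρ * ρ = 1) (h : a * ρ * a = ρ) : IsUnit a :=
  ⟨⟨a, ρ * a * ρ, by rw [← mul_assoc, ← mul_assoc, h, hρ], by
    rw [mul_assoc, mul_assoc, ← mul_assoc a, h, hρ]⟩, rfl⟩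

/-- With `x` the point of the sphere over `z`, and `y = (z⋆, 1)`, the matrix `x x⋆ - ρ_D` is
`y (1 + z x₁ x₁⋆ z⋆) y⋆`, so that `ρ_D (2 x x⋆ ρ_D - 1)` is a sum of positive matrices. -/
lemma isStrictlyPositive_embD (z : openDisk A) : IsStrictlyPositive (embD z) := by
  refine (isUnit_of_mul_mul_eq rhoD_mul_self
    (embD_mul_rhoD_mul_embD z)).isStrictlyPositive ?_
  have hp : IsStrictlyPositive (1 - star (z : A) * z) := isStrictlyPositive_one_sub_star_mul z.2
  have hw := sectionD_zero_mul_star z.2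
  have h1 : star (z : A) * (z * (1 - star (z : A) * z)⁻¹ʳ) = (1 - star (z : A) * z)⁻¹ʳ - 1 := by
    have := Ring.mul_inverse_cancel _ hp.isUnit
    rw [sub_mul, one_mul, mul_assoc] at this
    exact eq_sub_of_add_eq' (sub_eq_iff_eq_add.1 this).symm
  have h2 : (1 - star (z : A) * z)⁻¹ʳ * (star (z : A) * z) = (1 - star (z : A) * z)⁻¹ʳ - 1 := by
    have := Ring.inverse_mul_cancel _ hp.isUnit
    rw [mul_sub, mul_one] at this
    exact eq_sub_of_add_eq' (sub_eq_iff_eq_add.1 this).symm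
  rw [← hw] at h1 h2
  set x := sectionD (z : A) with hx
  obtain ⟨y, hy0, hy1⟩ : ∃ y : Fin 2 → A, y 0 = star (z : A) ∧ y 1 = 1 := ⟨![_, _], rfl, rfl⟩
  obtain ⟨y', hy0', hy1'⟩ : ∃ y' : Fin 2 → A, y' 0 = star (z : A) * (z * x 0) ∧ y' 1 = z * x 0 :=
    ⟨![_, _], rfl, rfl⟩
  have key : embD z = rhoD A * (ofM (Matrix.vecMulVec x (star x)) +
      (ofM (Matrix.vecMulVec y (star y)) + ofM (Matrix.vecMulVec y' (star y')))) * rhoD A := by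
    rw [embD, PhiD, rhoD_mul_reflOf, ← hx, hx, sectionD_one, ← hx]
    refine M2_ext fun i j => ?_
    have h4 : star (z : A) * (z * (x 0 * (star (x 0) * star (z : A)))) =
        x 0 * (star (x 0) * star (z : A)) - star (z : A) := by
      calc _ = star (z : A) * (z * (x 0 * star (x 0))) * star (z : A) := by
            simp only [mul_assoc]
        _ = _ := by rw [h1, sub_mul, one_mul, mul_assoc]
    have h5 : z * (x 0 * (star (x 0) * (star (z : A) * z))) =
        z * (x 0 * star (x 0)) - z := by
      calc _ = z * (x 0 * star (x 0) * (star (z : A) * z)) := by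
            simp only [mul_assoc]
        _ = _ := by rw [h2, mul_sub, mul_one]
    have hx1 : x 1 = z * x 0 := by rw [hx, sectionD_one]
    fin_cases i <;> fin_cases j <;>
      simp [toM_mul_apply, toM_add, rhoD, toM_ofM, Matrix.vecMulVec_apply, hy0, hy1, hy0', hy1',
        mul_assoc, mul_sub, h1, h4, h5, hx1] <;> abel
  rw [key]
  nth_rw 2 [← star_rhoD]
  exact star_right_conjugate_nonneg (add_nonneg (ofM_vecMulVec_star_nonneg _)
    (add_nonneg (ofM_vecMulVec_star_nonneg _) (ofM_vecMulVec_star_nonneg _))) _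

/-- The inverse of the embedding of the disk, in terms of the entries. -/
def diskCoord (a : M2 A) : A := -(toM a 1 0 * (toM a 0 0 + 1)⁻¹ʳ)

lemma isUnit_toM_zero_zero_add_one {a : M2 A} (ha : 0 ≤ a) : IsUnit (toM a 0 0 + 1) :=
  (isStrictlyPositive_one.nonneg_add (toM_apply_self_nonneg ha 0)).isUnit

lemma diskCoord_embD (z : openDisk A) : diskCoord (embD z) = z := by
  have hu := isUnit_toM_zero_zero_add_one (isStrictlyPositive_embD z).nonneg
  have h : toM (embD z) 1 0 = -(z * (toM (embD z) 0 0 + 1)) := by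
    rw [embD_eq]
    simp [toM_ofM, mul_add]
  rw [diskCoord, h, neg_mul, neg_neg, mul_assoc, Ring.mul_inverse_cancel _ hu, mul_one]

lemma embD_injective : Function.Injective (embD (A := A)) := fun z₁ z₂ h => by
  rw [Subtype.ext_iff, ← diskCoord_embD z₁, h, diskCoord_embD]

/-- The image of the disk is the set of the fixed points of `a ↦ ρ_D a⁻¹ ρ_D`. -/
lemma exists_embD_eq {a : M2 A} (ha : IsStrictlyPositive a) (haρ : a * rhoD A * a = rhoD A) :
    ∃ z, embD z = a := by
  set p := toM a 0 0 with hp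
  set q := toM a 0 1 with hq
  set r := toM a 1 1 with hr
  have hsa : ∀ i j, star (toM a j i) = toM a i j := fun i j =>
    congrFun (congrFun (congrArg toM ha.isSelfAdjoint.star_eq) i) j
  have h10 : toM a 1 0 = star q := (hsa 1 0).symm
  have hent : ∀ i j, toM (a * rhoD A * a) i j = toM (rhoD A) i j := fun i j => by rw [haρ]
  have e00 : p * p - q * star q = 1 := by
    have := hent 0 0
    simpa [toM_mul_apply, rhoD, toM_ofM, h10, ← hp, ← hq, sub_eq_add_neg] using this
  have e01 : p * q = q * r := by
    have := hent 0 1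
    rw [← sub_eq_zero]
    simpa [toM_mul_apply, rhoD, toM_ofM, h10, ← hp, ← hq, ← hr, sub_eq_add_neg] using this
  have e11 : star q * q - r * r = -1 := by
    have := hent 1 1
    simpa [toM_mul_apply, rhoD, toM_ofM, h10, ← hp, ← hq, ← hr, sub_eq_add_neg] using this
  have hp1 : IsStrictlyPositive (p + 1) :=
    isStrictlyPositive_one.nonneg_add (toM_apply_self_nonneg ha.nonneg 0)
  have hr1 : IsStrictlyPositive (r + 1) :=
    isStrictlyPositive_one.nonneg_add (toM_apply_self_nonneg ha.nonneg 1)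
  set N := (p + 1)⁻¹ʳ with hN
  have hN1 : (p + 1) * N = 1 := Ring.mul_inverse_cancel _ hp1.isUnit
  have hN2 : N * (p + 1) = 1 := Ring.inverse_mul_cancel _ hp1.isUnit
  have hNs : star N = N := hp1.ringInverse.isSelfAdjoint.star_eq
  have hz : diskCoord a = -(star q * N) := by rw [diskCoord, h10]
  have hzs : star (diskCoord a) = -(N * q) := by
    rw [hz, star_neg, star_mul, star_star, hNs]
  -- `1 - z⋆ z = 2 (p + 1)⁻¹`, which shows that `z` is in the disk and gives the first entry.
  have hone : 1 - star (diskCoord a) * diskCoord a = N + N := by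
    have h1 : q * star q = (p + 1) * (p - 1) := by
      rw [eq_sub_of_add_eq' (sub_eq_iff_eq_add.1 e00).symm]
      noncomm_ring
    rw [hzs, hz, neg_mul_neg]
    calc 1 - N * q * (star q * N) = 1 - N * (q * star q) * N := by simp only [mul_assoc]
      _ = 1 - (N * (p + 1)) * ((p + 1) * N - (N + N)) := by rw [h1]; noncomm_ring
      _ = N + N := by rw [hN1, hN2]; noncomm_ring
  have hmem : diskCoord a ∈ openDisk A := by
    refine norm_lt_one_of_isStrictlyPositive ?_
    rw [hone]
    exact hp1.ringInverse.add_nonneg hp1.ringInverse.nonneg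
  have hw : (1 - star (diskCoord a) * diskCoord a)⁻¹ʳ + (1 - star (diskCoord a) * diskCoord a)⁻¹ʳ =
      p + 1 := by
    have hu := (isStrictlyPositive_one_sub_star_mul (show ‖diskCoord a‖ < 1 from hmem)).isUnit
    have h1 := Ring.inverse_mul_cancel _ hu
    rw [hone] at h1 ⊢
    calc _ = ((N + N)⁻¹ʳ + (N + N)⁻¹ʳ) * (N * (p + 1)) := by rw [hN2, mul_one]
      _ = ((N + N)⁻¹ʳ * (N + N)) * (p + 1) := by noncomm_ring
      _ = p + 1 := by rw [h1, one_mul]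
  have h11 : star q * N * q = r - 1 := by
    have h1 : N * q * (r + 1) = q := by
      calc N * q * (r + 1) = N * (q * r + q) := by rw [mul_assoc, mul_add, mul_one]
        _ = N * (p + 1) * q := by rw [← e01]; noncomm_ring
        _ = q := by rw [hN2, one_mul]
    have h2 : star q * N * q * (r + 1) = (r - 1) * (r + 1) := by
      rw [mul_assoc (star q), mul_assoc (star q), h1, sub_eq_iff_eq_add.1 e11]
      noncomm_ring
    exact hr1.isUnit.mul_right_cancel h2
  refine ⟨⟨diskCoord a, hmem⟩, ?_⟩
  rw [embD_eq]
  generalize (1 - star (diskCoord a) * diskCoord a)⁻¹ʳ = W at hw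
  refine M2_ext fun i j => ?_
  fin_cases i <;> fin_cases j
  · simp [toM_ofM, hw, ← hp]
  · simp [toM_ofM, ← add_mul, hw, hzs, ← mul_assoc, hN1, ← hq]
  · simp [toM_ofM, ← mul_add, hw, hz, mul_assoc, hN2, h10]
  · have h : ∀ x y : A, x * W * y + x * W * y = x * (W + W) * y := fun x y => by noncomm_ring
    have h' : star q * (N * ((p + 1) * (N * q))) = r - 1 := by
      rw [← mul_assoc N, hN2, one_mul, ← mul_assoc, h11]
    change diskCoord a * W * star (diskCoord a) + diskCoord a * W * star (diskCoord a) + 1 = r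
    rw [h, hw, hzs, hz]
    simp [mul_assoc, h']

lemma isC1Curve_openDisk_iff (c : ℝ → openDisk A) :
    IsC1Curve c ↔ ContDiffOn ℝ 1 (fun t => embD (c t)) (Set.Icc 0 1) := by
  constructor
  · intro (hc : ContDiffOn ℝ 1 (fun t => (c t : A)) (Set.Icc 0 1))
    have hs : ContDiffOn ℝ 1 (fun t => star (c t : A)) (Set.Icc 0 1) := contDiffOn_star hc
    have hw : ContDiffOn ℝ 1 (fun t => (1 - star (c t : A) * c t)⁻¹ʳ) (Set.Icc 0 1) :=
      contDiffOn_ringInverse (contDiffOn_const.sub (hs.mul hc)) fun t _ =>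
        (isStrictlyPositive_one_sub_star_mul (c t).2).isUnit
    rw [contDiffOn_M2_iff]
    intro i j
    simp only [embD_eq, toM_ofM]
    fin_cases i <;> fin_cases j
    · exact (hw.add hw).sub contDiffOn_const
    · exact ((hw.mul hs).add (hw.mul hs)).neg
    · exact ((hc.mul hw).add (hc.mul hw)).neg
    · exact (((hc.mul hw).mul hs).add ((hc.mul hw).mul hs)).add contDiffOn_const
  · intro h
    rw [contDiffOn_M2_iff] at h
    have h1 : ContDiffOn ℝ 1 (fun t => diskCoord (embD (c t))) (Set.Icc 0 1) := by
      refine ((h 1 0).mul (contDiffOn_ringInverse ((h 0 0).add contDiffOn_const) fun t _ => ?_)).neg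
      exact isUnit_toM_zero_zero_add_one (isStrictlyPositive_embD (c t)).nonneg
    simp only [diskCoord_embD] at h1
    exact h1

theorem isNonposCurvedLengthSpace_openDisk :
    IsNonposCurvedLengthSpace (dD (A := A)) IsGeodesicD IsC1Curve lengthD :=
  isNonposCurvedLengthSpace_of_embedding isStrictlyPositive_embD embD_injective
    (fun x y t => exists_embD_eq
      (isStrictlyPositive_geoMean (isStrictlyPositive_embD x) (isStrictlyPositive_embD y) t)
      (geoMean_mul_mul_geoMean rhoD_mul_self star_rhoD (isStrictlyPositive_embD x)
        (isStrictlyPositive_embD y) (embD_mul_rhoD_mul_embD x) (embD_mul_rhoD_mul_embD y) t))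
    isC1Curve_openDisk_iff

/-! ### The Cayley transform -/

lemma isUnit_one_sub_I_smul {h : A} (hh : h ∈ halfSpace A) : IsUnit (1 - Complex.I • h) := by
  have hh' : IsStrictlyPositive (ℑ h : A) := hh
  have e : 1 - Complex.I • h = (1 + (ℑ h : A)) + Complex.I • (-(ℜ h : A)) := by
    nth_rw 1 [← realPart_add_I_smul_imaginaryPart h]
    rw [smul_add, smul_smul, Complex.I_mul_I, smul_neg, neg_one_smul]
    abel
  rw [e]
  exact isUnit_add_I_smul (isStrictlyPositive_one.add_nonneg hh'.nonneg) (ℜ h).2.neg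

/-- `Im h = i (h⋆ - h) / 2`, multiplied by `4`: this multiple occurs in `1 - Γ(h)⋆ Γ(h)`. -/
lemma imaginaryPart_smul_eq {B : Type*} [CStarAlgebra B] (h : B) :
    (4 : ℝ) • (ℑ h : B) = (2 : ℝ) • (Complex.I • (star h - h)) := by
  have e1 : star h = (ℜ h : B) - Complex.I • (ℑ h : B) := by
    nth_rw 1 [← realPart_add_I_smul_imaginaryPart h]
    rw [star_add, star_smul, (ℜ h).2.star_eq, (ℑ h).2.star_eq]
    simp [sub_eq_add_neg]
  have e2 : star h - h = (-2 * Complex.I) • (ℑ h : B) := by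
    rw [e1]
    nth_rw 3 [← realPart_add_I_smul_imaginaryPart h]
    module
  rw [e2, smul_smul]
  have : Complex.I * (-2 * Complex.I) = 2 := by
    linear_combination (-2 : ℂ) * Complex.I_mul_I
  rw [this]
  have : (2 : ℂ) • (ℑ h : B) = (2 : ℝ) • (ℑ h : B) := by
    rw [← Complex.coe_smul]
    norm_num
  rw [this, smul_smul]
  norm_num

lemma isUnit_one_add {z : A} (hz : z ∈ openDisk A) : IsUnit (1 + z) := by
  have : IsUnit (1 - -z) := isUnit_one_sub_of_norm_lt_one (by rwa [norm_neg])
  rwa [sub_neg_eq_add] at this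

lemma star_I_smul {B : Type*} [CStarAlgebra B] (h : B) :
    star (Complex.I • h) = -(Complex.I • star h) := by
  rw [star_smul]
  simp

/-- `1 - Γ(h)⋆ Γ(h)` is congruent to `4 Im h`. -/
lemma cayley_mem {h : A} (hh : h ∈ halfSpace A) : cayley h ∈ openDisk A := by
  have hh' : IsStrictlyPositive (ℑ h : A) := hh
  have hu := isUnit_one_sub_I_smul hh
  refine norm_lt_one_of_isStrictlyPositive ?_
  set d := 1 - Complex.I • h with hd
  have h1 : d * d⁻¹ʳ = 1 := Ring.mul_inverse_cancel _ hu
  have h1' : star (d⁻¹ʳ) * star d = 1 := by rw [← star_mul, h1, star_one]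
  have h2 : star d * d - star (1 + Complex.I • h) * (1 + Complex.I • h) =
      (4 : ℝ) • (ℑ h : A) := by
    rw [imaginaryPart_smul_eq, hd, star_sub, star_add, star_one, star_I_smul, smul_sub,
      two_smul]
    generalize Complex.I • star h = Y
    generalize Complex.I • h = X
    noncomm_ring
  have h3 : 1 - star (cayley h) * cayley h =
      star (d⁻¹ʳ) * ((4 : ℝ) • (ℑ h : A)) * d⁻¹ʳ := by
    rw [← h2, cayley, ← hd, star_mul, mul_sub, sub_mul]
    have : star (d⁻¹ʳ) * (star d * d) * d⁻¹ʳ = 1 := by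
      rw [← mul_assoc, h1', one_mul, h1]
    rw [this]
    simp only [mul_assoc]
  rw [h3, hu.ringInverse.isStrictlyPositive_star_left_conjugate_iff]
  exact hh'.smul (by norm_num)

/-- The imaginary part of `i (1 - z) (1 + z)⁻¹` is congruent to `1 - z⋆ z`. -/
lemma cayleyInv_mem {z : A} (hz : z ∈ openDisk A) : cayleyInv z ∈ halfSpace A := by
  have hu := isUnit_one_add hz
  change IsStrictlyPositive (ℑ (cayleyInv z) : A)
  set d := 1 + z with hd
  have h1 : d * d⁻¹ʳ = 1 := Ring.mul_inverse_cancel _ hu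
  have h1' : star (d⁻¹ʳ) * star d = 1 := by rw [← star_mul, h1, star_one]
  have h2 : star d * (1 - z) + star (1 - z) * d = (2 : ℝ) • (1 - star z * z) := by
    rw [hd, star_add, star_sub, star_one, two_smul]
    noncomm_ring
  have h3 : (4 : ℝ) • (ℑ (cayleyInv z) : A) =
      (2 : ℝ) • (star (d⁻¹ʳ) * ((2 : ℝ) • (1 - star z * z)) * d⁻¹ʳ) := by
    rw [imaginaryPart_smul_eq, ← h2, cayleyInv, ← hd, star_I_smul, smul_sub, smul_neg, smul_smul,
      smul_smul, Complex.I_mul_I, neg_one_smul, neg_one_smul, neg_neg, sub_neg_eq_add, star_mul,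
      mul_add, add_mul]
    have e1 : star (d⁻¹ʳ) * (star d * (1 - z)) * d⁻¹ʳ = (1 - z) * d⁻¹ʳ := by
      rw [← mul_assoc, h1', one_mul]
    have e2 : star (d⁻¹ʳ) * (star (1 - z) * d) * d⁻¹ʳ = star (d⁻¹ʳ) * star (1 - z) := by
      rw [mul_assoc, mul_assoc, h1, mul_one]
    rw [e1, e2, add_comm]
  have h4 : (ℑ (cayleyInv z) : A) = (4⁻¹ : ℝ) •
      ((2 : ℝ) • (star (d⁻¹ʳ) * ((2 : ℝ) • (1 - star z * z)) * d⁻¹ʳ)) := by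
    rw [← h3, smul_smul]
    norm_num
  rw [h4]
  refine IsStrictlyPositive.smul (by norm_num) (IsStrictlyPositive.smul (by norm_num) ?_)
  rw [hu.ringInverse.isStrictlyPositive_star_left_conjugate_iff]
  exact (isStrictlyPositive_one_sub_star_mul hz).smul (by norm_num)

lemma cayleyInv_cayley {h : A} (hh : h ∈ halfSpace A) : cayleyInv (cayley h) = h := by
  have hu := isUnit_one_sub_I_smul hh
  have hv := isUnit_one_add (cayley_mem hh)
  set d := 1 - Complex.I • h with hd
  have h1 : d * d⁻¹ʳ = 1 := Ring.mul_inverse_cancel _ hu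
  have e1 : 1 + cayley h = d⁻¹ʳ + d⁻¹ʳ := by
    have : ∀ X D : A, (1 - X) * D + (1 + X) * D = D + D := fun X D => by noncomm_ring
    rw [cayley, ← hd, ← this (Complex.I • h) d⁻¹ʳ, ← hd, h1]
  have e2 : Complex.I • (1 - cayley h) = h * (1 + cayley h) := by
    have : ∀ X D : A, (1 - X) * D - (1 + X) * D = -(X * (D + D)) := fun X D => by noncomm_ring
    rw [e1]
    nth_rw 1 [← h1]
    rw [cayley, ← hd, hd, this, smul_neg, smul_mul_assoc, smul_smul, Complex.I_mul_I,
      neg_one_smul, neg_neg]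
  rw [cayleyInv, ← smul_mul_assoc, e2, mul_assoc, Ring.mul_inverse_cancel _ hv, mul_one]

lemma cayley_cayleyInv {z : A} (hz : z ∈ openDisk A) : cayley (cayleyInv z) = z := by
  have hu := isUnit_one_add hz
  have hv := isUnit_one_sub_I_smul (cayleyInv_mem hz)
  have h1 : (1 + z) * (1 + z)⁻¹ʳ = 1 := Ring.mul_inverse_cancel _ hu
  have e0 : Complex.I • cayleyInv z = -((1 - z) * (1 + z)⁻¹ʳ) := by
    rw [cayleyInv, smul_smul, Complex.I_mul_I, neg_one_smul]
  have e2 : 1 + Complex.I • cayleyInv z = z * (1 - Complex.I • cayleyInv z) := by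
    rw [e0, sub_neg_eq_add]
    generalize (1 + z)⁻¹ʳ = D at h1
    calc 1 + -((1 - z) * D) = (1 + z) * D + -((1 - z) * D) := by rw [h1]
      _ = z * ((1 + z) * D + (1 - z) * D) := by noncomm_ring
      _ = z * (1 + (1 - z) * D) := by rw [h1]
  rw [cayley, e2, mul_assoc, Ring.mul_inverse_cancel _ hv, mul_one]

/-- The Cayley transform, as a bijection. -/
def cayleyEquiv : halfSpace A ≃ openDisk A where
  toFun h := ⟨cayley (h : A), cayley_mem h.2⟩
  invFun z := ⟨cayleyInv (z : A), cayleyInv_mem z.2⟩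
  left_inv h := Subtype.ext (cayleyInv_cayley h.2)
  right_inv z := Subtype.ext (cayley_cayleyInv z.2)

lemma contDiffOn_cayley (n : WithTop ℕ∞) : ContDiffOn ℝ n (cayley (A := A)) (halfSpace A) := by
  have h : ContDiffOn ℝ n (fun h : A => Complex.I • h) (halfSpace A) :=
    contDiffOn_id.const_smul Complex.I
  exact (contDiffOn_const.add h).mul
    (contDiffOn_ringInverse (contDiffOn_const.sub h) fun _ ht => isUnit_one_sub_I_smul ht)

lemma contDiffOn_cayleyInv (n : WithTop ℕ∞) :
    ContDiffOn ℝ n (cayleyInv (A := A)) (openDisk A) :=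
  ((contDiffOn_const.sub contDiffOn_id).mul
    (contDiffOn_ringInverse (contDiffOn_const.add contDiffOn_id) fun _ ht =>
      isUnit_one_add ht)).const_smul Complex.I

/-! ### The half-space -/

/-- The complex number `1 / √2`. -/
def invSqrtTwo : ℂ := ((√2)⁻¹ : ℝ)

lemma invSqrtTwo_mul_self : invSqrtTwo * invSqrtTwo = 1 / 2 := by
  have h : ((√2)⁻¹ : ℝ) * (√2)⁻¹ = 1 / 2 := by
    rw [← mul_inv, Real.mul_self_sqrt (by norm_num)]
    norm_num
  rw [invSqrtTwo, ← Complex.ofReal_mul, h]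
  norm_num

lemma star_invSqrtTwo : star invSqrtTwo = invSqrtTwo := Complex.conj_ofReal _

lemma invSqrtTwo_ne_zero : invSqrtTwo ≠ 0 := fun h => by
  have := invSqrtTwo_mul_self
  rw [h] at this
  norm_num at this

/-- The unitary matrix with rows `(1, -i) / √2` and `(1, i) / √2`. It carries the form of `ρ_H` to
the form of `ρ_D`, and acts on the ratios `x₂ x₁⁻¹` as the Cayley transform. -/
def cayleyMatrix (A : Type*) [CStarAlgebra A] [PartialOrder A] [StarOrderedRing A] : M2 A :=
  ofM !![invSqrtTwo • 1, -(invSqrtTwo • Complex.I • (1 : A));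
    invSqrtTwo • 1, invSqrtTwo • Complex.I • (1 : A)]

lemma half_smul_one_add {B : Type*} [CStarAlgebra B] :
    (2⁻¹ : ℂ) • (1 : B) + (2⁻¹ : ℂ) • (1 : B) = 1 := by
  rw [← add_smul]
  norm_num

lemma cayleyMatrix_mul_star : cayleyMatrix A * star (cayleyMatrix A) = 1 := by
  refine M2_ext fun i j => ?_
  rw [toM_mul_apply, toM_star, toM_one]
  fin_cases i <;> fin_cases j <;>
    simp [cayleyMatrix, toM_ofM, star_invSqrtTwo, smul_smul, mul_assoc, mul_left_comm,
      invSqrtTwo_mul_self, half_smul_one_add]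

lemma star_mul_cayleyMatrix : star (cayleyMatrix A) * cayleyMatrix A = 1 := by
  refine M2_ext fun i j => ?_
  rw [toM_mul_apply, toM_star, toM_one]
  fin_cases i <;> fin_cases j <;>
    simp [cayleyMatrix, toM_ofM, star_invSqrtTwo, smul_smul, mul_assoc, mul_left_comm,
      invSqrtTwo_mul_self, half_smul_one_add]

lemma rhoD_mul_cayleyMatrix : rhoD A * cayleyMatrix A = cayleyMatrix A * rhoH A := by
  refine M2_ext fun i j => ?_
  rw [toM_mul_apply, toM_mul_apply]
  fin_cases i <;> fin_cases j <;>
    simp [cayleyMatrix, rhoD, rhoH, toM_ofM, smul_smul, mul_left_comm, mul_comm]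

lemma star_rhoH : star (rhoH A) = rhoH A := by
  refine M2_ext fun i j => ?_
  rw [toM_star]
  fin_cases i <;> fin_cases j <;> simp [rhoH, toM_ofM]

lemma rhoH_mul_self : rhoH A * rhoH A = 1 := by
  refine M2_ext fun i j => ?_
  rw [toM_mul_apply, toM_one]
  fin_cases i <;> fin_cases j <;> simp [rhoH, toM_ofM, smul_smul]

lemma star_cayleyMatrix_mul_rhoD :
    star (cayleyMatrix A) * rhoD A = rhoH A * star (cayleyMatrix A) := by
  have := congrArg star (rhoD_mul_cayleyMatrix (A := A))
  rwa [star_mul, star_mul, star_rhoD, star_rhoH] at this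

lemma cayleyMatrix_mulVec_zero (x : Fin 2 → A) :
    (toM (cayleyMatrix A) *ᵥ x) 0 = invSqrtTwo • (x 0 - Complex.I • x 1) := by
  simp [Matrix.mulVec, dotProduct, cayleyMatrix, toM_ofM, sub_eq_add_neg]

lemma cayleyMatrix_mulVec_one (x : Fin 2 → A) :
    (toM (cayleyMatrix A) *ᵥ x) 1 = invSqrtTwo • (x 0 + Complex.I • x 1) := by
  simp [Matrix.mulVec, dotProduct, cayleyMatrix, toM_ofM, smul_add]

lemma projOf_cayleyMatrix_mulVec (x : Fin 2 → A) :
    projOf (rhoD A) (toM (cayleyMatrix A) *ᵥ x) =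
      cayleyMatrix A * projOf (rhoH A) x * star (cayleyMatrix A) := by
  have h : ofM (Matrix.vecMulVec (toM (cayleyMatrix A) *ᵥ x) (star (toM (cayleyMatrix A) *ᵥ x))) =
      cayleyMatrix A * ofM (Matrix.vecMulVec x (star x)) * star (cayleyMatrix A) := by
    refine M2_ext fun i j => ?_
    simp only [toM_mul_apply, toM_star, toM_ofM, Matrix.vecMulVec_apply, Pi.star_apply,
      Matrix.conjTranspose_apply, Matrix.mulVec, dotProduct, Fin.sum_univ_two, star_add, star_mul]
    noncomm_ring
  rw [projOf, projOf, h, mul_assoc, star_cayleyMatrix_mul_rhoD]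
  simp only [mul_assoc]

lemma rhoD_mul_reflOf_cayleyMatrix_mulVec (x : Fin 2 → A) :
    rhoD A * reflOf (rhoD A) (toM (cayleyMatrix A) *ᵥ x) =
      cayleyMatrix A * (rhoH A * reflOf (rhoH A) x) * star (cayleyMatrix A) := by
  have h : reflOf (rhoD A) (toM (cayleyMatrix A) *ᵥ x) =
      cayleyMatrix A * reflOf (rhoH A) x * star (cayleyMatrix A) := by
    rw [reflOf, reflOf, projOf_cayleyMatrix_mulVec, mul_sub, sub_mul, mul_one,
      cayleyMatrix_mul_star]
    noncomm_ring
  rw [h, ← mul_assoc, ← mul_assoc, rhoD_mul_cayleyMatrix]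
  simp only [mul_assoc]

/-- The unitary `cayleyMatrix` maps the sphere of `ρ_H` over `h` into the sphere of `ρ_D` over
`Γ(h)`. -/
lemma cayleyMatrix_mulVec_mem {h : A} (hh : h ∈ halfSpace A) {x : Fin 2 → A}
    (hx : x ∈ sphere (rhoH A)) (hxh : ratio x = h) :
    toM (cayleyMatrix A) *ᵥ x ∈ sphere (rhoD A) ∧
      ratio (toM (cayleyMatrix A) *ᵥ x) = cayley h := by
  obtain ⟨hx1, hx0⟩ := hx
  have hu := isUnit_one_sub_I_smul hh
  have hr : x 1 = h * x 0 := by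
    rw [← hxh, ratio, mul_assoc, Ring.inverse_mul_cancel _ hx0, mul_one]
  have e0 : x 0 - Complex.I • x 1 = (1 - Complex.I • h) * x 0 := by
    rw [hr, sub_mul, one_mul, smul_mul_assoc]
  have e1 : x 0 + Complex.I • x 1 = (1 + Complex.I • h) * x 0 := by
    rw [hr, add_mul, one_mul, smul_mul_assoc]
  have hy0 : IsUnit (x 0 - Complex.I • x 1) := e0 ▸ hu.mul hx0
  have hy0' : IsUnit ((toM (cayleyMatrix A) *ᵥ x) 0) := by
    rw [cayleyMatrix_mulVec_zero]
    exact hy0.smul (Units.mk0 _ invSqrtTwo_ne_zero)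
  refine ⟨⟨?_, hy0'⟩, ?_⟩
  · rw [← hx1]
    have l : form (rhoD A) (toM (cayleyMatrix A) *ᵥ x) (toM (cayleyMatrix A) *ᵥ x) =
        star ((toM (cayleyMatrix A) *ᵥ x) 0) * (toM (cayleyMatrix A) *ᵥ x) 0 -
          star ((toM (cayleyMatrix A) *ᵥ x) 1) * (toM (cayleyMatrix A) *ᵥ x) 1 := by
      generalize toM (cayleyMatrix A) *ᵥ x = y
      simp [form, innerA, rhoD, toM_ofM, Matrix.mulVec, dotProduct, sub_eq_add_neg]
    have r : form (rhoH A) x x =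
        Complex.I • (star (x 1) * x 0) - Complex.I • (star (x 0) * x 1) := by
      simp [form, innerA, rhoH, toM_ofM, Matrix.mulVec, dotProduct, sub_eq_add_neg]
    rw [l, r, cayleyMatrix_mulVec_zero, cayleyMatrix_mulVec_one]
    simp only [star_smul, star_invSqrtTwo, star_add, star_sub, Complex.star_def, Complex.conj_I,
      add_mul, mul_add, sub_mul, mul_sub, smul_mul_assoc, mul_smul_comm]
    match_scalars
    · ring
    · linear_combination (2 * Complex.I) * invSqrtTwo_mul_self
    · linear_combination (-(2 * Complex.I)) * invSqrtTwo_mul_self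
    · ring
  · have hc : ((toM (cayleyMatrix A) *ᵥ x) 1) = cayley h * (toM (cayleyMatrix A) *ᵥ x) 0 := by
      rw [cayleyMatrix_mulVec_zero, cayleyMatrix_mulVec_one, mul_smul_comm, e0, e1, cayley,
        ← mul_assoc, mul_assoc (1 + Complex.I • h), Ring.inverse_mul_cancel _ hu, mul_one]
    rw [ratio, hc, mul_assoc, Ring.mul_inverse_cancel _ hy0', mul_one]

/-- In the positive matrices, the Cayley transform is a unitary conjugation. -/
lemma embD_cayleyEquiv (h : halfSpace A) :
    embD (cayleyEquiv h) = cayleyMatrix A * embH h * star (cayleyMatrix A) := by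
  obtain ⟨hx, hr⟩ := sectionH_mem h.2
  obtain ⟨hy, hs⟩ := cayleyMatrix_mulVec_mem h.2 hx hr
  rw [embD, ← reflOf_eq_PhiD (cayleyEquiv h).2 hy hs, rhoD_mul_reflOf_cayleyMatrix_mulVec]
  rfl

lemma embH_eq (h : halfSpace A) :
    embH h = star (cayleyMatrix A) * embD (cayleyEquiv h) * cayleyMatrix A := by
  rw [embD_cayleyEquiv]
  calc embH h = (star (cayleyMatrix A) * cayleyMatrix A) * embH h *
        (star (cayleyMatrix A) * cayleyMatrix A) := by
        rw [star_mul_cayleyMatrix, one_mul, mul_one]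
    _ = _ := by simp only [mul_assoc]

lemma isUnit_cayleyMatrix : IsUnit (cayleyMatrix A) :=
  ⟨⟨_, _, cayleyMatrix_mul_star, star_mul_cayleyMatrix⟩, rfl⟩

lemma isStrictlyPositive_embH (h : halfSpace A) : IsStrictlyPositive (embH h) := by
  rw [embH_eq, isUnit_cayleyMatrix.isStrictlyPositive_star_left_conjugate_iff]
  exact isStrictlyPositive_embD _

lemma dD_cayleyEquiv (h₁ h₂ : halfSpace A) :
    dD (cayleyEquiv h₁) (cayleyEquiv h₂) = dH h₁ h₂ := by
  rw [dD, dH, embD_cayleyEquiv, embD_cayleyEquiv,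
    dg_conj (isStrictlyPositive_embH h₁) (isStrictlyPositive_embH h₂) isUnit_cayleyMatrix rfl]

lemma embH_injective : Function.Injective (embH (A := A)) := fun h₁ h₂ h =>
  cayleyEquiv.injective (embD_injective (by rw [embD_cayleyEquiv, embD_cayleyEquiv, h]))

lemma conj_mul_rhoD_mul_conj_iff (a : M2 A) :
    (cayleyMatrix A * a * star (cayleyMatrix A)) * rhoD A *
      (cayleyMatrix A * a * star (cayleyMatrix A)) = rhoD A ↔ a * rhoH A * a = rhoH A := by
  have h1 : (cayleyMatrix A * a * star (cayleyMatrix A)) * rhoD A *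
      (cayleyMatrix A * a * star (cayleyMatrix A)) =
      cayleyMatrix A * (a * rhoH A * a) * star (cayleyMatrix A) := by
    calc _ = cayleyMatrix A * a * (star (cayleyMatrix A) * rhoD A) *
          (cayleyMatrix A * a * star (cayleyMatrix A)) := by simp only [mul_assoc]
      _ = cayleyMatrix A * (a * rhoH A * (star (cayleyMatrix A) * cayleyMatrix A) * a) *
          star (cayleyMatrix A) := by rw [star_cayleyMatrix_mul_rhoD]; simp only [mul_assoc]
      _ = _ := by rw [star_mul_cayleyMatrix, mul_one]
  have h2 : rhoD A = cayleyMatrix A * rhoH A * star (cayleyMatrix A) := by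
    rw [← rhoD_mul_cayleyMatrix, mul_assoc, cayleyMatrix_mul_star, mul_one]
  rw [h1]
  nth_rw 1 [h2]
  rw [(isUnit_cayleyMatrix (A := A)).star.mul_left_inj,
    (isUnit_cayleyMatrix (A := A)).mul_right_inj]

lemma exists_embH_eq {a : M2 A} (ha : IsStrictlyPositive a) (haρ : a * rhoH A * a = rhoH A) :
    ∃ h, embH h = a := by
  obtain ⟨z, hz⟩ := exists_embD_eq
    (isUnit_cayleyMatrix.isStrictlyPositive_star_right_conjugate_iff.2 ha)
    ((conj_mul_rhoD_mul_conj_iff a).2 haρ)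
  refine ⟨cayleyEquiv.symm z, ?_⟩
  rw [← cayleyEquiv.apply_symm_apply z, embD_cayleyEquiv] at hz
  rwa [(isUnit_cayleyMatrix (A := A)).star.mul_left_inj,
    (isUnit_cayleyMatrix (A := A)).mul_right_inj] at hz

lemma embH_mul_rhoH_mul_embH (h : halfSpace A) : embH h * rhoH A * embH h = rhoH A := by
  rw [← conj_mul_rhoD_mul_conj_iff, ← embD_cayleyEquiv]
  exact embD_mul_rhoD_mul_embD _

lemma isC1Curve_halfSpace_iff (c : ℝ → halfSpace A) :
    IsC1Curve c ↔ ContDiffOn ℝ 1 (fun t => embH (c t)) (Set.Icc 0 1) := by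
  have h1 : IsC1Curve c ↔ IsC1Curve fun t => cayleyEquiv (c t) := by
    constructor
    · intro h
      exact (contDiffOn_cayley 1).comp h fun t _ => (c t).2
    · intro h
      have h2 := (contDiffOn_cayleyInv 1).comp h fun t _ => (cayleyEquiv (c t)).2
      refine ContDiffOn.congr h2 fun t _ => ?_
      exact (cayleyInv_cayley (c t).2).symm
  rw [h1, isC1Curve_openDisk_iff]
  constructor
  · intro h
    simp only [embH_eq]
    exact (contDiffOn_const.mul h).mul contDiffOn_const
  · intro h
    simp only [embD_cayleyEquiv]
    exact (contDiffOn_const.mul h).mul contDiffOn_const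

theorem isNonposCurvedLengthSpace_halfSpace :
    IsNonposCurvedLengthSpace (dH (A := A)) IsGeodesicH IsC1Curve lengthH :=
  isNonposCurvedLengthSpace_of_embedding isStrictlyPositive_embH embH_injective
    (fun x y t => exists_embH_eq
      (isStrictlyPositive_geoMean (isStrictlyPositive_embH x) (isStrictlyPositive_embH y) t)
      (geoMean_mul_mul_geoMean rhoH_mul_self star_rhoH (isStrictlyPositive_embH x)
        (isStrictlyPositive_embH y) (embH_mul_rhoH_mul_embH x) (embH_mul_rhoH_mul_embH y) t))
    isC1Curve_halfSpace_iff

end CStarPoincare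

end

open CStarPoincare
theorem mainTheorem2 {A : Type*} [CStarAlgebra A] [PartialOrder A] [StarOrderedRing A] :
    IsNonposCurvedLengthSpace (dH (A := A)) IsGeodesicH IsC1Curve lengthH ∧
    IsNonposCurvedLengthSpace (dD (A := A)) IsGeodesicD IsC1Curve lengthD ∧
    ∃ Γ : halfSpace A ≃ openDisk A,
      (∀ h, (Γ h : A) = cayley (h : A)) ∧
      (∀ z, (Γ.symm z : A) = cayleyInv (z : A)) ∧
      ContDiffOn ℝ ∞ (cayley (A := A)) (halfSpace A) ∧
      ContDiffOn ℝ ∞ (cayleyInv (A := A)) (openDisk A) ∧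
      ∀ h₁ h₂, dD (Γ h₁) (Γ h₂) = dH h₁ h₂ :=
  ⟨isNonposCurvedLengthSpace_halfSpace, isNonposCurvedLengthSpace_openDisk, cayleyEquiv,
    fun _ => rfl, fun _ => rfl, contDiffOn_cayley _, contDiffOn_cayleyInv _, dD_cayleyEquiv⟩
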